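/- Cubes are cubes in $\mathbf R^n$ with sides parallel to the coordinate axes, and $2Q$ is the two-times concentric dilation of $Q$. A measure $\mu$ is doubling if $\mu(2Q)\le D\mu(Q)$ for all cubes $Q$, with a finite constant $D$; equivalently, there is a finite constant $A$ (a doubling constant of $\mu$) with $\mu(Q')\le A\,\mu(Q)$ whenever $Q\subset Q'$ are cubes and the side of $Q'$ is twice the side of $Q$ (for Lebesgue measure $A=2^n$). For $\delta>0$ write $(\mu_1,\mu_2)\in C(\delta)$, with constant $C<\infty$, if $$\frac{\mu_1(E)}{\mu_1(Q)}\le C\left(\frac{\mu_2(E)}{\mu_2(Q)}\right)^{\delta}$$ for all cubes $Q$ and all measurable $E\subset Q$. For $\varepsilon>0$ write $(\nu,\mu)\in RH(\varepsilon)$ if there is a locally $\mu$-integrable function $\sigma\ge 0$ with $d\nu=\sigma\,d\mu$ and a finite constant $K$ with $$\left(\frac1{\mu(Q)}\int_Q\sigma^{1+\varepsilon}\,d\mu\right)^{1/(1+\varepsilon)}\le\frac{K}{\mu(Q)}\int_Q\sigma\,d\mu\quad\text{for all cubes }Q.$$ **Theorem 3.** Let $\mu_1,\mu_2$ be nonzero,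 locally finite nonnegative Borel measures on $\mathbf R^n$. (a) If at least one of $\mu_1,\mu_2$ is doubling and $(\mu_1,\mu_2)\in C(\delta)$ for some $\delta>0$, then both measures are doubling. Now let both measures be doubling. (b) Suppose $(\mu_1,\mu_2)\in C(\delta)$ with constant $C$, where $\delta>0$. Then $C\ge1$, all doubling constants of $\mu_1$ and $\mu_2$ are at least $1$, and $(\mu_1,\mu_2)\in RH(\varepsilon(\delta))$, where, for any doubling constant $A$ of $\mu_2$, $$\varepsilon(\delta)=\frac{-\frac12\log\frac12}{\log A+\frac{\log(2C)}{\delta}}.$$ Also $(\mu_2,\mu_1)\in RH(\tilde\varepsilon(\delta))$, where, for any doubling constant $A$ of $\mu_1$, $$\tilde\varepsilon(\delta)=\frac{-\frac12\log\bigl(1-(2C)^{-1/\delta}\bigr)}{\log A+\log 2}.$$ For fixed $A,C\ge1$ both $\varepsilon$ and $\tilde\varepsilon$ are positive, continuous and strictly increasing functions of $\delta\in(0,\infty)$. (c) For every $\varepsilon>0$, if $(\mu_1,\mu_2)\in RH(\varepsilon)$, then $(\mu_1,\mu_2)\in C(\varepsilon/(1+\varepsilon))$; and if $(\mu_2,\mu_1)\in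 RH(\varepsilon)$, then $(\mu_2,\mu_1)\in C(\varepsilon/(1+\varepsilon))$. -/

import Mathlib

open MeasureTheory
open scoped NNReal ENNReal

/-- The closed cube in `ℝⁿ` with sides parallel to the coordinate axes, centre `c` and side
length `2 * r`. Its two-times concentric dilation is `cube c (2 * r)`. -/
def cube {n : ℕ} (c : Fin n → ℝ) (r : ℝ) : Set (Fin n → ℝ) :=
  {x | ∀ i, |x i - c i| ≤ r}

/-- `μ` is doubling: `μ(2Q) ≤ D μ(Q)` for all cubes `Q`, with a finite constant `D`. -/
def IsDoubling {n : ℕ} (μ : Measure (Fin n → ℝ)) : Prop :=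
  ∃ D : ℝ≥0, ∀ (c : Fin n → ℝ) (r : ℝ), 0 < r →
    μ (cube c (2 * r)) ≤ D * μ (cube c r)

/-- `μ(Q') ≤ A μ(Q)` whenever `Q ⊆ Q'` are cubes and the side of `Q'` is twice that of `Q`.
For Lebesgue measure this holds with `A = 2 ^ n`. -/
def IsDoublingConst {n : ℕ} (μ : Measure (Fin n → ℝ)) (A : ℝ≥0) : Prop :=
  ∀ (c c' : Fin n → ℝ) (r : ℝ), 0 < r → cube c r ⊆ cube c' (2 * r) →
    μ (cube c' (2 * r)) ≤ A * μ (cube c r)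

/-- A measure is doubling exactly if it has a constant in the sense of `IsDoublingConst`. -/
theorem isDoubling_iff_exists_isDoublingConst {n : ℕ} (μ : Measure (Fin n → ℝ)) :
    IsDoubling μ ↔ ∃ A : ℝ≥0, IsDoublingConst μ A := by
  constructor
  · rintro ⟨D, hD⟩
    refine ⟨D * D, fun c c' r hr h => ?_⟩
    have hsub : cube c' (2 * r) ⊆ cube c (2 * (2 * r)) := by
      intro x hx i
      have h1 := h (show (fun j => c j + r) ∈ cube c r from fun j => by
        simp [abs_of_pos hr]) i
      have h2 := h (show (fun j => c j - r) ∈ cube c r from fun j => by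
        simp [abs_of_pos hr]) i
      have h3 := hx i
      simp only [abs_le] at h1 h2 h3 ⊢
      constructor <;> linarith [h1.1, h1.2, h2.1, h2.2, h3.1, h3.2]
    calc μ (cube c' (2 * r)) ≤ μ (cube c (2 * (2 * r))) := measure_mono hsub
      _ ≤ D * μ (cube c (2 * r)) := hD c (2 * r) (by linarith)
      _ ≤ D * (D * μ (cube c r)) := by gcongr; exact hD c r hr
      _ = ((D * D : ℝ≥0) : ℝ≥0∞) * μ (cube c r) := by push_cast; ring
  · rintro ⟨A, hA⟩
    exact ⟨A, fun c r hr => hA c c r hr fun x hx i => (hx i).trans (by linarith)⟩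

/-- `μ₁(E) / μ₁(Q) ≤ C (μ₂(E) / μ₂(Q)) ^ δ` for all cubes `Q` and all measurable `E ⊆ Q`. -/
def ComparableWith {n : ℕ} (μ₁ μ₂ : Measure (Fin n → ℝ)) (C : ℝ≥0) (δ : ℝ) : Prop :=
  ∀ (c : Fin n → ℝ) (r : ℝ), 0 < r →
    ∀ E : Set (Fin n → ℝ), MeasurableSet E → E ⊆ cube c r →
      μ₁ E / μ₁ (cube c r) ≤ C * (μ₂ E / μ₂ (cube c r)) ^ δ

/-- The class `C(δ)`: comparability with parameter `δ > 0` and some finite constant. -/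
def MemC {n : ℕ} (μ₁ μ₂ : Measure (Fin n → ℝ)) (δ : ℝ) : Prop :=
  0 < δ ∧ ∃ C : ℝ≥0, ComparableWith μ₁ μ₂ C δ

/-- `dν = σ dμ` for a nonnegative, locally `μ`-integrable function `σ` that satisfies the reverse
Hölder inequality with exponent `1 + ε` with respect to `μ`, uniformly over all cubes. -/
def HasReverseHolderDensity {n : ℕ} (ν μ : Measure (Fin n → ℝ)) (ε : ℝ) : Prop :=
  ∃ σ : (Fin n → ℝ) → ℝ, (∀ x, 0 ≤ σ x) ∧ LocallyIntegrable σ μ ∧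
    ν = μ.withDensity (fun x => ENNReal.ofReal (σ x)) ∧
    ∃ K : ℝ≥0, ∀ (c : Fin n → ℝ) (r : ℝ), 0 < r →
      ((∫⁻ x in cube c r, ENNReal.ofReal (σ x) ^ (1 + ε) ∂μ) / μ (cube c r)) ^ (1 / (1 + ε)) ≤
        K * ((∫⁻ x in cube c r, ENNReal.ofReal (σ x) ∂μ) / μ (cube c r))

/-- The exponent function `ε(δ)` for the density of `μ₁` with respect to `μ₂`, where `A` is a
doubling constant of `μ₂` and `C` is the constant in the comparability of `μ₁` to `μ₂`. -/
noncomputable def epsFun (A C δ : ℝ) : ℝ :=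
  (-(1 / 2) * Real.log (1 / 2)) / (Real.log A + Real.log (2 * C) / δ)

/-- The exponent function for the density of `μ₂` with respect to `μ₁`, where `A` is a doubling
constant of `μ₁` and `C` is the constant in the comparability of `μ₁` to `μ₂`. -/
noncomputable def epsFunSwap (A C δ : ℝ) : ℝ :=
  (-(1 / 2) * Real.log (1 - (2 * C) ^ (-(1 / δ)))) / (Real.log A + Real.log 2)

/-!
Cubes are closed balls of the sup norm, so the covering and differentiation theorems of Mathlib
apply to them.

**Transfer of doubling.** If `μ₁` is doubling, the inequality of `C(δ)` for `Q ⊆ 2Q` bounds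
`μ₂ Q / μ₂ (2Q)` from below. If `μ₂` is doubling, thin shells of cubes have small relative
`μ₂`-measure (`IsDoubling.exists_measure_thin_shell_le`, from Vitali's covering lemma), hence carry
at most half of the `μ₁`-measure of the cube; shrinking by a fixed ratio close to `1` thus costs a
factor `2`, and boundedly many such steps halve the side. The same shell estimate shows that the
boundaries of cubes are null, so that half-open dyadic cells and closed cubes are interchangeable
and a doubling constant for closed cubes can be used, without loss, for dyadic cells.

**Comparability implies reverse Hölder.** The inequality of `C(δ)` says that subsets of a cube of
relative `μ`-measure at most `α` have relative `ν`-measure at most `β` (`IsAbsContOnCubes`), with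
`α = (2C)^(-1/δ)`, `β = 1/2` for `ν = μ₁`, `μ = μ₂`, and with `α = 1/2`, `β = 1 - (2C)^(-1/δ)` for the
two measures interchanged, by passing to complements. Fix a cube `Q` and decompose it into dyadic
cells, stopping where `ν P / μ P` first exceeds a level. On a stopping cell this ratio is at most
`A` times the level, so raising the level by the factor `A / α` leaves a level set of relative
`μ`-measure at most `α`, and hence of relative `ν`-measure at most `β`, in the cell. The `ν`-measure
of the level sets at the levels `(ν Q / μ Q) (A / α)^k` therefore decays like `β^k`
(`IsAbsContOnCubes.measure_dyadicLevelSet_le`), while by Lebesgue differentiation the density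
`w = dν/dμ` is bounded by the level outside each of them. Summing over `k` bounds
`∫_Q w^(1+ε) dμ = ∫_Q w^ε dν` as soon as `(A / α)^ε β < 1`, and the exponents in the statement make
this product equal to `β^(1/2)`.

**Reverse Hölder implies comparability.** This is Hölder's inequality
(`HasReverseHolderDensity.memC`).
-/

open Metric Filter Topology

/-! ### Doubling measures: positivity and thin shells -/

theorem cube_eq_closedBall {n : ℕ} (c : Fin n → ℝ) {r : ℝ} (hr : 0 ≤ r) :
    cube c r = closedBall c r := by
  ext x
  simp [cube, mem_closedBall, dist_pi_le_iff hr, Real.dist_eq]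

theorem IsDoubling.exists_closedBall {n : ℕ} {μ : Measure (Fin n → ℝ)} (h : IsDoubling μ) :
    ∃ D : ℝ≥0, ∀ (c : Fin n → ℝ) (r : ℝ), 0 < r →
      μ (closedBall c (2 * r)) ≤ D * μ (closedBall c r) := by
  obtain ⟨D, hD⟩ := h
  refine ⟨D, fun c r hr => ?_⟩
  have := hD c r hr
  rwa [cube_eq_closedBall c hr.le, cube_eq_closedBall c (by positivity)] at this

theorem IsDoubling.isUnifLocDoublingMeasure {n : ℕ} {μ : Measure (Fin n → ℝ)}
    (h : IsDoubling μ) : IsUnifLocDoublingMeasure μ := by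
  obtain ⟨D, hD⟩ := h.exists_closedBall
  refine ⟨D, ?_⟩
  filter_upwards [self_mem_nhdsWithin] with r hr x using hD x r hr

theorem IsDoubling.measure_closedBall_two_pow_mul_le {n : ℕ} {μ : Measure (Fin n → ℝ)} {D : ℝ≥0}
    (hD : ∀ (c : Fin n → ℝ) (r : ℝ), 0 < r → μ (closedBall c (2 * r)) ≤ D * μ (closedBall c r))
    (c : Fin n → ℝ) {r : ℝ} (hr : 0 < r) (k : ℕ) :
    μ (closedBall c (2 ^ k * r)) ≤ D ^ k * μ (closedBall c r) := by
  induction k with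
  | zero => simp
  | succ k ih =>
    calc μ (closedBall c (2 ^ (k + 1) * r)) = μ (closedBall c (2 * (2 ^ k * r))) := by
          congr 2; ring
      _ ≤ D * μ (closedBall c (2 ^ k * r)) := hD c _ (by positivity)
      _ ≤ D * (D ^ k * μ (closedBall c r)) := by gcongr
      _ = D ^ (k + 1) * μ (closedBall c r) := by ring

/-- A nonzero doubling measure charges every ball: a null ball would have null dilates, and these
exhaust the space. -/
theorem IsDoubling.measure_closedBall_ne_zero {n : ℕ} {μ : Measure (Fin n → ℝ)}
    (h : IsDoubling μ) (hμ : μ ≠ 0) (c : Fin n → ℝ) {r : ℝ} (hr : 0 < r) :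
    μ (closedBall c r) ≠ 0 := by
  intro h0
  obtain ⟨D, hD⟩ := h.exists_closedBall
  apply hμ
  rw [← Measure.measure_univ_eq_zero]
  have hU : (Set.univ : Set (Fin n → ℝ)) ⊆ ⋃ k : ℕ, closedBall c (2 ^ k * r) := by
    intro x _
    obtain ⟨k, hk⟩ := pow_unbounded_of_one_lt (dist x c / r) (one_lt_two)
    exact Set.mem_iUnion.2 ⟨k, mem_closedBall.2 ((div_le_iff₀ hr).1 hk.le)⟩
  refine measure_mono_null hU (measure_iUnion_null fun k => ?_)
  have := IsDoubling.measure_closedBall_two_pow_mul_le hD c hr k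
  rw [h0, mul_zero] at this
  exact nonpos_iff_eq_zero.1 this

theorem IsDoubling.measure_cube_ne_zero {n : ℕ} {μ : Measure (Fin n → ℝ)}
    (h : IsDoubling μ) (hμ : μ ≠ 0) (c : Fin n → ℝ) {r : ℝ} (hr : 0 < r) :
    μ (cube c r) ≠ 0 := by
  rw [cube_eq_closedBall c hr.le]
  exact h.measure_closedBall_ne_zero hμ c hr

theorem measure_cube_ne_top {n : ℕ} (μ : Measure (Fin n → ℝ)) [IsLocallyFiniteMeasure μ]
    (c : Fin n → ℝ) {r : ℝ} (hr : 0 < r) : μ (cube c r) ≠ ∞ := by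
  rw [cube_eq_closedBall c hr.le]
  exact measure_closedBall_lt_top.ne

/-- The outer shell of a cube is controlled by the next shell inside. Every point of the outer
shell is pushed inwards by `2 * s`; the balls of radius `s` about the pushed points lie in the inner
shell, and by Vitali's covering lemma and doubling, disjoint ones among them carry a fixed
proportion of the outer shell. -/
theorem IsDoubling.exists_measure_shell_le {n : ℕ} {μ : Measure (Fin n → ℝ)} (h : IsDoubling μ) :
    ∃ K : ℝ≥0, ∀ (c : Fin n → ℝ) (R s : ℝ), 0 < s → 4 * s < R →
      μ (closedBall c R \ closedBall c (R - s)) ≤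
        K * μ (closedBall c (R - s) \ closedBall c (R - 4 * s)) := by
  obtain ⟨D, hD⟩ := h.exists_closedBall
  refine ⟨D ^ 3, fun c R s hs hR => ?_⟩
  let p : (Fin n → ℝ) → (Fin n → ℝ) := fun x => c + (1 - 2 * s / dist x c) • (x - c)
  set T := closedBall c R \ closedBall c (R - s)
  have hT : ∀ x ∈ T, dist x c ≤ R ∧ R - s < dist x c := fun x hx =>
    ⟨mem_closedBall.1 hx.1, by simpa using hx.2⟩
  have hp1 : ∀ x ∈ T, dist (p x) c = dist x c - 2 * s := by
    intro x hx
    obtain ⟨h1, h2⟩ := hT x hx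
    have h3 : 0 < dist x c := by linarith
    have h4 : 2 * s / dist x c ≤ 1 := by rw [div_le_one h3]; linarith
    simp only [p, dist_eq_norm, add_sub_cancel_left, norm_smul, Real.norm_eq_abs] at h3 h4 ⊢
    rw [abs_of_nonneg (by linarith)]
    field_simp
  have hp2 : ∀ x ∈ T, dist x (p x) = 2 * s := by
    intro x hx
    obtain ⟨h1, h2⟩ := hT x hx
    have h3 : 0 < dist x c := by linarith
    have : x - p x = (2 * s / dist x c) • (x - c) := by
      simp only [p]; rw [sub_smul, one_smul]; abel
    rw [dist_eq_norm, this, norm_smul, Real.norm_eq_abs, abs_of_pos (by positivity),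
      ← dist_eq_norm]
    field_simp
  obtain ⟨u, huT, hdisj, hcov⟩ := Vitali.exists_disjoint_subfamily_covering_enlargement_closedBall
    T p (fun _ => s) s (fun _ _ => le_rfl) 4 (by norm_num)
  have hu : u.Countable := hdisj.countable_of_nonempty_interior fun a _ =>
    (nonempty_ball.2 hs).mono ball_subset_interior_closedBall
  have hsub : T ⊆ ⋃ a ∈ u, closedBall (p a) (2 ^ 3 * s) := by
    intro x hx
    obtain ⟨b, hb, hxb⟩ := hcov x hx
    have h1 := mem_closedBall.1 (hxb (mem_closedBall_self hs.le))
    have h2 := dist_triangle x (p x) (p b)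
    rw [hp2 x hx] at h2
    exact Set.mem_biUnion hb (mem_closedBall.2 (by linarith))
  have hin : (⋃ a ∈ u, closedBall (p a) s) ⊆ closedBall c (R - s) \ closedBall c (R - 4 * s) := by
    refine Set.iUnion₂_subset fun a ha y hy => ?_
    have h1 := hp1 a (huT ha)
    obtain ⟨h2, h3⟩ := hT a (huT ha)
    have h4 := mem_closedBall.1 hy
    have h5 := dist_triangle y (p a) c
    have h6 := dist_triangle (p a) y c
    rw [dist_comm (p a) y] at h6
    refine ⟨mem_closedBall.2 (by linarith), fun h7 => ?_⟩
    have := mem_closedBall.1 h7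
    linarith
  calc μ T ≤ μ (⋃ a ∈ u, closedBall (p a) (2 ^ 3 * s)) := measure_mono hsub
    _ ≤ ∑' a : u, μ (closedBall (p a) (2 ^ 3 * s)) := measure_biUnion_le μ hu _
    _ ≤ ∑' a : u, D ^ 3 * μ (closedBall (p a) s) :=
        ENNReal.tsum_le_tsum fun a => IsDoubling.measure_closedBall_two_pow_mul_le hD _ hs 3
    _ = D ^ 3 * μ (⋃ a ∈ u, closedBall (p a) s) := by
        rw [ENNReal.tsum_mul_left,
          measure_biUnion hu hdisj fun a _ => measurableSet_closedBall]
    _ ≤ ((D ^ 3 : ℝ≥0) : ℝ≥0∞) * _ := by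
        rw [ENNReal.coe_pow]; gcongr

/-- Thin shells of a cube have small relative measure, uniformly over all cubes: the shells of
relative thickness `4⁻ᵏ / 5` decay geometrically in measure. -/
theorem IsDoubling.exists_measure_thin_shell_le {n : ℕ} {μ : Measure (Fin n → ℝ)}
    [IsLocallyFiniteMeasure μ] (h : IsDoubling μ) {η : ℝ≥0∞} (hη : η ≠ 0) :
    ∃ t : ℝ, 0 < t ∧ t < 1 ∧ ∀ (c : Fin n → ℝ) (R : ℝ), 0 < R →
      μ (closedBall c R \ closedBall c ((1 - t) * R)) ≤ η * μ (closedBall c R) := by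
  obtain ⟨K, hK⟩ := h.exists_measure_shell_le
  set θ : ℝ≥0 := K / (K + 1)
  have hθ : θ < 1 := by
    rw [div_lt_one (by positivity)]; exact lt_add_one K
  have hdecay : ∀ (c : Fin n → ℝ) (R : ℝ), 0 < R → ∀ k : ℕ,
      μ (closedBall c R \ closedBall c ((1 - (1 / 4) ^ k / 5) * R)) ≤
        (θ : ℝ≥0∞) ^ k * μ (closedBall c R) := by
    intro c R hR k
    induction k with
    | zero => simpa using measure_mono Set.sdiff_subset
    | succ k ih =>
      have h4 : ((1 : ℝ) / 4) ^ k ≤ 1 := pow_le_one₀ (by norm_num) (by norm_num)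
      have h4' : 0 < ((1 : ℝ) / 4) ^ k := by positivity
      set s : ℝ := (1 / 4) ^ (k + 1) / 5 * R with hs
      have e1 : (1 - (1 / 4) ^ (k + 1) / 5) * R = R - s := by rw [hs]; ring
      have e2 : (1 - (1 / 4) ^ k / 5) * R = R - 4 * s := by rw [hs, pow_succ]; ring
      have hspos : 0 < s := by positivity
      have hsR : 4 * s < R := by
        rw [hs, pow_succ]; nlinarith
      rw [e1]
      rw [e2] at ih
      have hKs := hK c R s hspos hsR
      set a := μ (closedBall c R \ closedBall c (R - s))
      set b := μ (closedBall c (R - s) \ closedBall c (R - 4 * s))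
      have hab : a + b ≤ μ (closedBall c R \ closedBall c (R - 4 * s)) := by
        rw [← measure_union (Set.disjoint_left.2 fun x hx hx' => hx.2 hx'.1)
          (measurableSet_closedBall.diff measurableSet_closedBall)]
        refine measure_mono (Set.union_subset (fun x hx => ⟨hx.1, fun hx' => hx.2 ?_⟩)
          fun x hx => ⟨?_, hx.2⟩)
        · exact closedBall_subset_closedBall (by linarith) hx'
        · exact closedBall_subset_closedBall (by linarith) hx.1
      have ha : a ≤ θ * (a + b) := by
        have : (θ : ℝ≥0∞) = K / (K + 1) := by
          rw [ENNReal.coe_div (by positivity)]; simp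
        rw [this, ← ENNReal.mul_div_right_comm, ENNReal.le_div_iff_mul_le (by simp) (by simp)]
        calc a * (K + 1) = K * a + a := by ring
          _ ≤ K * a + K * b := by gcongr
          _ = K * (a + b) := by ring
      calc a ≤ θ * (a + b) := ha
        _ ≤ θ * (θ ^ k * μ (closedBall c R)) := by gcongr; exact hab.trans ih
        _ = θ ^ (k + 1) * μ (closedBall c R) := by ring
  obtain ⟨k, hk⟩ : ∃ k : ℕ, (θ : ℝ≥0∞) ^ k < η :=
    ((ENNReal.tendsto_pow_atTop_nhds_zero_of_lt_one (by exact_mod_cast hθ)).eventually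
      (gt_mem_nhds (pos_iff_ne_zero.2 hη))).exists
  have h4 : ((1 : ℝ) / 4) ^ k ≤ 1 := pow_le_one₀ (by norm_num) (by norm_num)
  refine ⟨(1 / 4) ^ k / 5, by positivity, by linarith, fun c R hR => ?_⟩
  exact (hdecay c R hR k).trans (by gcongr)

theorem IsDoubling.measure_sphere {n : ℕ} {μ : Measure (Fin n → ℝ)}
    [IsLocallyFiniteMeasure μ] (h : IsDoubling μ) (c : Fin n → ℝ) {R : ℝ} (hR : 0 < R) :
    μ (sphere c R) = 0 := by
  have key : ∀ η : ℝ≥0∞, η ≠ 0 → μ (sphere c R) ≤ η * μ (closedBall c R) := by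
    intro η hη
    obtain ⟨t, ht0, -, ht⟩ := h.exists_measure_thin_shell_le hη
    refine (measure_mono fun x hx => ?_).trans (ht c R hR)
    have := mem_sphere.1 hx
    refine ⟨sphere_subset_closedBall hx, fun h' => ?_⟩
    have := mem_closedBall.1 h'
    nlinarith
  have hlim : Tendsto (fun η : ℝ≥0∞ => η * μ (closedBall c R)) (𝓝[>] 0) (𝓝 0) := by
    have h1 := ENNReal.Tendsto.mul_const (b := μ (closedBall c R))
      (tendsto_id (α := ℝ≥0∞) (x := 𝓝 0)) (Or.inr measure_closedBall_lt_top.ne)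
    simp only [id, zero_mul] at h1
    exact h1.mono_left nhdsWithin_le_nhds
  refine nonpos_iff_eq_zero.1 (ge_of_tendsto hlim ?_)
  filter_upwards [self_mem_nhdsWithin] with η hη using key η (ne_of_gt hη)

/-! ### Comparability transfers the doubling property -/

theorem ComparableWith.div_closedBall_le {n : ℕ} {μ₁ μ₂ : Measure (Fin n → ℝ)} {C : ℝ≥0} {δ : ℝ}
    (h : ComparableWith μ₁ μ₂ C δ) {c : Fin n → ℝ} {r : ℝ} (hr : 0 < r) {E : Set (Fin n → ℝ)}
    (hE : MeasurableSet E) (hEQ : E ⊆ closedBall c r) :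
    μ₁ E / μ₁ (closedBall c r) ≤ C * (μ₂ E / μ₂ (closedBall c r)) ^ δ := by
  have := h c r hr E hE
  rw [cube_eq_closedBall c hr.le] at this
  exact this hEQ

theorem ENNReal.one_le_rpow_inv_mul_of_one_le {Y x : ℝ≥0∞} {δ : ℝ} (hδ : 0 < δ)
    (h : 1 ≤ Y * x ^ δ) : 1 ≤ Y ^ δ⁻¹ * x := by
  have := ENNReal.rpow_le_rpow h (inv_nonneg.2 hδ.le)
  rwa [ENNReal.one_rpow, ENNReal.mul_rpow_of_nonneg _ _ (inv_nonneg.2 hδ.le),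
    ENNReal.rpow_rpow_inv hδ.ne'] at this

theorem ComparableWith.isDoubling_right {n : ℕ} {μ₁ μ₂ : Measure (Fin n → ℝ)}
    [IsLocallyFiniteMeasure μ₁] [IsLocallyFiniteMeasure μ₂] (hμ₁ : μ₁ ≠ 0) {C : ℝ≥0} {δ : ℝ}
    (hδ : 0 < δ) (h : ComparableWith μ₁ μ₂ C δ) (h₁ : IsDoubling μ₁) : IsDoubling μ₂ := by
  obtain ⟨D, hD⟩ := h₁.exists_closedBall
  refine ⟨(D * C) ^ δ⁻¹, fun c r hr => ?_⟩
  rw [cube_eq_closedBall c hr.le, cube_eq_closedBall c (by positivity)]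
  have hsub : closedBall c r ⊆ closedBall c (2 * r) := closedBall_subset_closedBall (by linarith)
  have hcomp := h.div_closedBall_le (c := c) (r := 2 * r) (by positivity) measurableSet_closedBall hsub
  rcases eq_or_ne (μ₂ (closedBall c (2 * r))) 0 with h0 | h0
  · simp [h0]
  have hpos := h₁.measure_closedBall_ne_zero hμ₁ c (r := 2 * r) (by positivity)
  have hone : 1 ≤ (D * C : ℝ≥0∞) * (μ₂ (closedBall c r) / μ₂ (closedBall c (2 * r))) ^ δ := by
    calc (1 : ℝ≥0∞) = μ₁ (closedBall c (2 * r)) / μ₁ (closedBall c (2 * r)) :=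
          (ENNReal.div_self hpos measure_closedBall_lt_top.ne).symm
      _ ≤ D * μ₁ (closedBall c r) / μ₁ (closedBall c (2 * r)) := by gcongr; exact hD c r hr
      _ = D * (μ₁ (closedBall c r) / μ₁ (closedBall c (2 * r))) := mul_div_assoc _ _ _
      _ ≤ D * (C * (μ₂ (closedBall c r) / μ₂ (closedBall c (2 * r))) ^ δ) := by gcongr
      _ = _ := by ring
  have h2 := ENNReal.one_le_rpow_inv_mul_of_one_le hδ hone
  rw [← mul_div_assoc, ENNReal.le_div_iff_mul_le (Or.inl h0)
    (Or.inl measure_closedBall_lt_top.ne), one_mul] at h2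
  rwa [ENNReal.coe_rpow_of_nonneg _ (inv_nonneg.2 hδ.le), ENNReal.coe_mul]

/-- If `μ₂` is doubling, a shell of the cube that is thin enough has so little relative
`μ₂`-measure that it carries at most half of the `μ₁`-measure of the cube. Shrinking the cube
repeatedly by this fixed ratio halves its side in boundedly many steps. -/
theorem ComparableWith.isDoubling_left {n : ℕ} {μ₁ μ₂ : Measure (Fin n → ℝ)}
    [IsLocallyFiniteMeasure μ₁] [IsLocallyFiniteMeasure μ₂] {C : ℝ≥0} {δ : ℝ}
    (hδ : 0 < δ) (h : ComparableWith μ₁ μ₂ C δ) (h₂ : IsDoubling μ₂) : IsDoubling μ₁ := by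
  obtain ⟨η, hη0, hη⟩ : ∃ η : ℝ≥0∞, η ≠ 0 ∧ (C : ℝ≥0∞) * η ^ δ ≤ 2⁻¹ := by
    refine ⟨((2 * (C + 1) : ℝ≥0) : ℝ≥0∞)⁻¹ ^ δ⁻¹, ?_, ?_⟩
    · simp [ENNReal.rpow_eq_zero_iff, ENNReal.mul_eq_top, hδ]
    · rw [ENNReal.rpow_inv_rpow hδ.ne', ← div_eq_mul_inv]
      refine ENNReal.div_le_of_le_mul ?_
      rw [ENNReal.coe_mul, ← mul_assoc]
      push_cast
      rw [ENNReal.inv_mul_cancel (by simp) (by simp), one_mul]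
      exact le_self_add
  obtain ⟨t, ht0, ht1, ht⟩ := h₂.exists_measure_thin_shell_le hη0
  have step : ∀ (c : Fin n → ℝ) (R : ℝ), 0 < R →
      μ₁ (closedBall c R) ≤ 2 * μ₁ (closedBall c ((1 - t) * R)) := by
    intro c R hR
    rcases eq_or_ne (μ₁ (closedBall c R)) 0 with h0 | h0
    · simp [h0]
    have hS := h.div_closedBall_le (c := c) hR
      (measurableSet_closedBall.diff (measurableSet_closedBall (x := c) (ε := (1 - t) * R)))
      Set.sdiff_subset
    have hS' : μ₁ (closedBall c R \ closedBall c ((1 - t) * R)) ≤ 2⁻¹ * μ₁ (closedBall c R) := by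
      rw [← ENNReal.div_le_iff h0 measure_closedBall_lt_top.ne]
      refine hS.trans (le_trans ?_ hη)
      gcongr
      exact ENNReal.div_le_of_le_mul (ht c R hR)
    have hsplit : μ₁ (closedBall c R) ≤
        2⁻¹ * μ₁ (closedBall c R) + μ₁ (closedBall c ((1 - t) * R)) := by
      calc μ₁ (closedBall c R) ≤ μ₁ ((closedBall c R \ closedBall c ((1 - t) * R)) ∪
            closedBall c ((1 - t) * R)) := measure_mono (by simp)
        _ ≤ _ := (measure_union_le _ _).trans (by gcongr)
    have hhalf : 2⁻¹ * μ₁ (closedBall c R) ≤ μ₁ (closedBall c ((1 - t) * R)) := by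
      have hfin : 2⁻¹ * μ₁ (closedBall c R) ≠ ∞ :=
        ENNReal.mul_ne_top (by simp) measure_closedBall_lt_top.ne
      refine (ENNReal.add_le_add_iff_left hfin).1 (le_trans (le_of_eq ?_) hsplit)
      rw [← add_mul, ENNReal.inv_two_add_inv_two, one_mul]
    calc μ₁ (closedBall c R) = 2 * (2⁻¹ * μ₁ (closedBall c R)) := by
          rw [← mul_assoc, ENNReal.mul_inv_cancel (by simp) (by simp), one_mul]
      _ ≤ _ := by gcongr
  have iter : ∀ (c : Fin n → ℝ) (R : ℝ), 0 < R → ∀ k : ℕ,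
      μ₁ (closedBall c R) ≤ 2 ^ k * μ₁ (closedBall c ((1 - t) ^ k * R)) := by
    intro c R hR k
    induction k with
    | zero => simp
    | succ k ih =>
      have := step c ((1 - t) ^ k * R) (mul_pos (pow_pos (by linarith) k) hR)
      calc μ₁ (closedBall c R) ≤ 2 ^ k * μ₁ (closedBall c ((1 - t) ^ k * R)) := ih
        _ ≤ 2 ^ k * (2 * μ₁ (closedBall c ((1 - t) * ((1 - t) ^ k * R)))) := by gcongr
        _ = 2 ^ (k + 1) * μ₁ (closedBall c ((1 - t) ^ (k + 1) * R)) := by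
          rw [pow_succ, mul_assoc, pow_succ' (1 - t), mul_assoc (1 - t)]
  obtain ⟨k, hk⟩ := exists_pow_lt_of_lt_one (show (0 : ℝ) < 1 / 2 by norm_num)
    (show 1 - t < 1 by linarith)
  refine ⟨2 ^ k, fun c r hr => ?_⟩
  rw [cube_eq_closedBall c hr.le, cube_eq_closedBall c (by positivity)]
  refine (iter c (2 * r) (by positivity) k).trans ?_
  push_cast
  gcongr
  nlinarith

/-! ### Reverse Hölder densities give comparability -/

theorem HasReverseHolderDensity.memC {n : ℕ} {ν μ : Measure (Fin n → ℝ)}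
    [IsLocallyFiniteMeasure μ] (hμ : ∀ (c : Fin n → ℝ) (r : ℝ), 0 < r → μ (cube c r) ≠ 0)
    {ε : ℝ} (hε : 0 < ε) (h : HasReverseHolderDensity ν μ ε) : MemC ν μ (ε / (1 + ε)) := by
  obtain ⟨σ, -, hσ, hν, K, hK⟩ := h
  refine ⟨by positivity, K, fun c r hr E hE hEQ => ENNReal.div_le_of_le_mul ?_⟩
  have hQ : MeasurableSet (cube c r) := by
    rw [cube_eq_closedBall c hr.le]; exact measurableSet_closedBall
  have hm0 := hμ c r hr
  have hmt := measure_cube_ne_top μ c hr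
  set f : (Fin n → ℝ) → ℝ≥0∞ := fun x => ENNReal.ofReal (σ x)
  have hf : AEMeasurable f μ := hσ.aestronglyMeasurable.aemeasurable.ennreal_ofReal
  have hνE : ν E = ∫⁻ x in E, f x ∂μ := by rw [hν, withDensity_apply _ hE]
  have hνQ : ν (cube c r) = ∫⁻ x in cube c r, f x ∂μ := by rw [hν, withDensity_apply _ hQ]
  have hpq : (1 + ε).HolderConjugate ((1 + ε) / ε) :=
    Real.holderConjugate_iff.2 ⟨by linarith, by field_simp⟩
  have hq : 1 / ((1 + ε) / ε) = ε / (1 + ε) := by field_simp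
  have holder : ∫⁻ x in E, f x ∂μ ≤
      (∫⁻ x in cube c r, f x ^ (1 + ε) ∂μ) ^ (1 / (1 + ε)) * μ E ^ (ε / (1 + ε)) := by
    have := ENNReal.lintegral_mul_le_Lp_mul_Lq (μ.restrict E) hpq hf.restrict
      (aemeasurable_const (b := (1 : ℝ≥0∞)))
    simp only [Pi.mul_apply, mul_one, ENNReal.one_rpow, lintegral_const,
      Measure.restrict_apply_univ, one_mul, hq] at this
    refine this.trans ?_
    gcongr
  set m := μ (cube c r)
  set I := ∫⁻ x in cube c r, f x ^ (1 + ε) ∂μ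
  have hRH := hK c r hr
  rw [← hνQ] at hRH
  have hp0 : 0 ≤ 1 / (1 + ε) := by positivity
  have hq0 : 0 ≤ ε / (1 + ε) := by positivity
  have hI : I ^ (1 / (1 + ε)) = (I / m) ^ (1 / (1 + ε)) * m ^ (1 / (1 + ε)) := by
    rw [← ENNReal.mul_rpow_of_nonneg _ _ hp0, ENNReal.div_mul_cancel hm0 hmt]
  have hE' : μ E ^ (ε / (1 + ε)) = (μ E / m) ^ (ε / (1 + ε)) * m ^ (ε / (1 + ε)) := by
    rw [← ENNReal.mul_rpow_of_nonneg _ _ hq0, ENNReal.div_mul_cancel hm0 hmt]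
  have hm : m ^ (1 / (1 + ε)) * m ^ (ε / (1 + ε)) = m := by
    rw [← ENNReal.rpow_add _ _ hm0 hmt, ← add_div, div_self (by positivity), ENNReal.rpow_one]
  rw [hνE]
  calc ∫⁻ x in E, f x ∂μ ≤ I ^ (1 / (1 + ε)) * μ E ^ (ε / (1 + ε)) := holder
    _ = (I / m) ^ (1 / (1 + ε)) * (μ E / m) ^ (ε / (1 + ε)) *
        (m ^ (1 / (1 + ε)) * m ^ (ε / (1 + ε))) := by rw [hI, hE']; ring
    _ ≤ K * (ν (cube c r) / m) * (μ E / m) ^ (ε / (1 + ε)) * m := by rw [hm]; gcongr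
    _ = K * (μ E / m) ^ (ε / (1 + ε)) * (ν (cube c r) / m * m) := by ring
    _ = K * (μ E / m) ^ (ε / (1 + ε)) * ν (cube c r) := by
        rw [ENNReal.div_mul_cancel hm0 hmt]

/-! ### The exponent functions -/

theorem Real.strictMonoOn_rpow_neg_one_div {b : ℝ} (hb : 1 < b) :
    StrictMonoOn (fun δ : ℝ => b ^ (-(1 / δ))) (Set.Ioi 0) := by
  intro x hx y hy hxy
  exact Real.rpow_lt_rpow_of_exponent_lt hb (neg_lt_neg (one_div_lt_one_div_of_lt hx hxy))

theorem Real.rpow_neg_one_div_lt_one {b δ : ℝ} (hb : 1 < b) (hδ : 0 < δ) :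
    b ^ (-(1 / δ)) < 1 :=
  Real.rpow_lt_one_of_one_lt_of_neg hb (by simpa using hδ)

theorem epsFun_properties {A C : ℝ} (hA : 1 ≤ A) (hC : 1 ≤ C) :
    (∀ δ : ℝ, 0 < δ → 0 < epsFun A C δ) ∧
      ContinuousOn (epsFun A C) (Set.Ioi 0) ∧ StrictMonoOn (epsFun A C) (Set.Ioi 0) := by
  have hlogA := Real.log_nonneg hA
  have hlogC : 0 < Real.log (2 * C) := Real.log_pos (by linarith)
  have hnum : 0 < -(1 / 2) * Real.log (1 / 2) := by
    have := Real.log_neg (show (0 : ℝ) < 1 / 2 by norm_num) (by norm_num); linarith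
  have hden : ∀ δ : ℝ, 0 < δ → 0 < Real.log A + Real.log (2 * C) / δ := fun δ hδ => by positivity
  refine ⟨fun δ hδ => div_pos hnum (hden δ hδ), ?_, fun x hx y hy hxy => ?_⟩
  · exact continuousOn_const.div (continuousOn_const.add
      (continuousOn_const.div continuousOn_id fun δ hδ => ne_of_gt hδ))
      fun δ hδ => (hden δ hδ).ne'
  · refine div_lt_div_of_pos_left hnum (hden y hy) ?_
    have := div_lt_div_of_pos_left hlogC hx hxy
    linarith

theorem epsFunSwap_properties {A C : ℝ} (hA : 1 ≤ A) (hC : 1 ≤ C) :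
    (∀ δ : ℝ, 0 < δ → 0 < epsFunSwap A C δ) ∧
      ContinuousOn (epsFunSwap A C) (Set.Ioi 0) ∧ StrictMonoOn (epsFunSwap A C) (Set.Ioi 0) := by
  have hden : 0 < Real.log A + Real.log 2 :=
    add_pos_of_nonneg_of_pos (Real.log_nonneg hA) (Real.log_pos (by norm_num))
  have hb : 1 < 2 * C := by linarith
  have hlt : ∀ δ : ℝ, 0 < δ → (2 * C) ^ (-(1 / δ)) < 1 := fun δ hδ =>
    Real.rpow_neg_one_div_lt_one hb hδ
  have hpos : ∀ δ : ℝ, 0 < (2 * C) ^ (-(1 / δ)) := fun δ => Real.rpow_pos_of_pos (by linarith) _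
  refine ⟨fun δ hδ => div_pos ?_ hden, ?_, fun x hx y hy hxy => ?_⟩
  · have := Real.log_neg (x := 1 - (2 * C) ^ (-(1 / δ))) (by linarith [hlt δ hδ])
      (by linarith [hpos δ])
    linarith
  · refine ContinuousOn.div_const (continuousOn_const.mul (ContinuousOn.log
      (continuousOn_const.sub (ContinuousOn.rpow continuousOn_const
        (continuousOn_const.div continuousOn_id fun δ hδ => ne_of_gt hδ).neg
        fun _ _ => Or.inl (by positivity))) fun δ hδ => ?_)) _
    exact (sub_pos.2 (hlt δ hδ)).ne'
  · refine div_lt_div_of_pos_right ?_ hden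
    have h1 := Real.strictMonoOn_rpow_neg_one_div hb hx hy hxy
    have h2 := Real.log_lt_log (x := 1 - (2 * C) ^ (-(1 / y))) (y := 1 - (2 * C) ^ (-(1 / x)))
      (by linarith [hlt y hy]) (by linarith)
    linarith

/-! ### Dyadic cells -/

/-- The index of the dyadic cell of generation `m` containing `x`, in the dyadic grid for which the
half-open cube with centre `c` and side length `2 * r` is a cell of generation `0`. -/
noncomputable def dyadicIndex {n : ℕ} (c : Fin n → ℝ) (r : ℝ) (m : ℕ) (x : Fin n → ℝ) :
    Fin n → ℤ :=
  fun i => ⌊(x i - (c i - r)) * 2 ^ m / (2 * r)⌋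

/-- The half-open dyadic cell of generation `m` containing `x`, as a fibre of `dyadicIndex`. The
cells of a generation partition the whole space, not only the cube with centre `c`. -/
def dyadicCell {n : ℕ} (c : Fin n → ℝ) (r : ℝ) (m : ℕ) (x : Fin n → ℝ) : Set (Fin n → ℝ) :=
  {y | dyadicIndex c r m y = dyadicIndex c r m x}

/-- The centre of the dyadic cell of generation `m` containing `x`. -/
noncomputable def dyadicCenter {n : ℕ} (c : Fin n → ℝ) (r : ℝ) (m : ℕ) (x : Fin n → ℝ) :
    Fin n → ℝ :=
  fun i => c i - r + (2 * dyadicIndex c r m x i + 1) * (r / 2 ^ m)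

section Dyadic

variable {n : ℕ} {c : Fin n → ℝ} {r : ℝ} {m : ℕ} {x y : Fin n → ℝ}

theorem mem_dyadicCell_self : x ∈ dyadicCell c r m x := rfl

theorem dyadicCell_eq_of_mem (h : y ∈ dyadicCell c r m x) :
    dyadicCell c r m y = dyadicCell c r m x := by
  ext z
  simp only [dyadicCell, Set.mem_ofPred_eq] at h ⊢
  rw [h]

theorem dyadicCell_succ_subset : dyadicCell c r (m + 1) x ⊆ dyadicCell c r m x := by
  have key : ∀ z : Fin n → ℝ, ∀ i, dyadicIndex c r m z i = dyadicIndex c r (m + 1) z i / 2 := by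
    intro z i
    have := Int.floor_div_natCast ((z i - (c i - r)) * 2 ^ (m + 1) / (2 * r)) 2
    simp only [dyadicIndex]
    push_cast at this
    rw [← this]
    congr 1
    rw [pow_succ]
    ring
  intro y hy
  funext i
  rw [key, key, congrFun hy i]

theorem dyadicCell_subset_of_le {m' : ℕ} (h : m ≤ m') :
    dyadicCell c r m' x ⊆ dyadicCell c r m x := by
  induction m', h using Nat.le_induction with
  | base => exact subset_rfl
  | succ k _ ih => exact dyadicCell_succ_subset.trans ih

theorem countable_range_dyadicCell : (Set.range (dyadicCell c r m)).Countable := by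
  have : Set.range (dyadicCell c r m) ⊆
      Set.range fun k : Fin n → ℤ => {y | dyadicIndex c r m y = k} := by
    rintro _ ⟨x, rfl⟩
    exact ⟨dyadicIndex c r m x, rfl⟩
  exact (Set.countable_range _).mono this

theorem measurableSet_dyadicCell : MeasurableSet (dyadicCell c r m x) := by
  have h : Measurable (dyadicIndex c r m) := by
    refine measurable_pi_iff.2 fun i => Int.measurable_floor.comp ?_
    fun_prop
  exact h (measurableSet_singleton (dyadicIndex c r m x))

theorem mem_dyadicCell_iff (hr : 0 < r) : y ∈ dyadicCell c r m x ↔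
    ∀ i, dyadicCenter c r m x i - r / 2 ^ m ≤ y i ∧
      y i < dyadicCenter c r m x i + r / 2 ^ m := by
  simp only [dyadicCell, Set.mem_ofPred_eq, funext_iff]
  refine forall_congr' fun i => ?_
  have h2 : (0 : ℝ) < 2 ^ m := by positivity
  generalize hk : dyadicIndex c r m x i = k
  simp only [dyadicCenter, hk]
  rw [dyadicIndex, Int.floor_eq_iff, le_div_iff₀ (by positivity), div_lt_iff₀ (by positivity)]
  have e1 : c i - r + (2 * (k : ℝ) + 1) * (r / 2 ^ m) - r / 2 ^ m =
      c i - r + k * (2 * r) / 2 ^ m := by field_simp; ring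
  have e2 : c i - r + (2 * (k : ℝ) + 1) * (r / 2 ^ m) + r / 2 ^ m =
      c i - r + (k + 1) * (2 * r) / 2 ^ m := by field_simp; ring
  rw [e1, e2, ← le_sub_iff_add_le', ← sub_lt_iff_lt_add', div_le_iff₀ h2, lt_div_iff₀ h2]

theorem dyadicCell_subset_closedBall (hr : 0 < r) :
    dyadicCell c r m x ⊆ closedBall (dyadicCenter c r m x) (r / 2 ^ m) := by
  intro y hy
  rw [mem_dyadicCell_iff hr] at hy
  rw [mem_closedBall, dist_pi_le_iff (by positivity)]
  intro i
  rw [Real.dist_eq, abs_le]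
  constructor <;> linarith [(hy i).1, (hy i).2]

theorem ball_subset_dyadicCell (hr : 0 < r) :
    ball (dyadicCenter c r m x) (r / 2 ^ m) ⊆ dyadicCell c r m x := by
  intro y hy
  rw [mem_ball, dist_pi_lt_iff (by positivity)] at hy
  rw [mem_dyadicCell_iff hr]
  intro i
  have := hy i
  rw [Real.dist_eq, abs_lt] at this
  constructor <;> linarith [this.1, this.2]

theorem dyadicCenter_zero (hr : 0 < r) : dyadicCenter c r 0 c = c := by
  funext i
  have : ⌊r / (2 * r)⌋ = 0 := by
    rw [Int.floor_eq_iff]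
    field_simp
    norm_num
  simp [dyadicCenter, dyadicIndex, this]

theorem closedBall_dyadicCenter_succ_subset (hr : 0 < r) :
    closedBall (dyadicCenter c r (m + 1) x) (r / 2 ^ (m + 1)) ⊆
      closedBall (dyadicCenter c r m x) (2 * (r / 2 ^ (m + 1))) := by
  have e : 2 * (r / 2 ^ (m + 1)) = r / 2 ^ m := by rw [pow_succ]; field_simp
  rw [e, ← closure_ball _ (by positivity : r / 2 ^ (m + 1) ≠ 0)]
  exact closure_minimal ((ball_subset_dyadicCell hr).trans
    (dyadicCell_succ_subset.trans (dyadicCell_subset_closedBall hr))) isClosed_closedBall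

theorem IsDoubling.measure_dyadicCell {μ : Measure (Fin n → ℝ)} [IsLocallyFiniteMeasure μ]
    (h : IsDoubling μ) (hr : 0 < r) : μ (dyadicCell c r m x) =
      μ (closedBall (dyadicCenter c r m x) (r / 2 ^ m)) := by
  refine le_antisymm (measure_mono (dyadicCell_subset_closedBall hr)) ?_
  rw [← ball_union_sphere]
  refine (measure_union_le _ _).trans ?_
  rw [h.measure_sphere _ (by positivity), add_zero]
  exact measure_mono (ball_subset_dyadicCell hr)

theorem IsDoublingConst.measure_dyadicCell_le {μ : Measure (Fin n → ℝ)} [IsLocallyFiniteMeasure μ]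
    (h : IsDoubling μ) {A : ℝ≥0} (hA : IsDoublingConst μ A) (hr : 0 < r) :
    μ (dyadicCell c r m x) ≤ A * μ (dyadicCell c r (m + 1) x) := by
  have hr' : 0 < r / 2 ^ (m + 1) := by positivity
  have e : 2 * (r / 2 ^ (m + 1)) = r / 2 ^ m := by rw [pow_succ]; field_simp
  have := hA (dyadicCenter c r (m + 1) x) (dyadicCenter c r m x) _ hr'
  rw [cube_eq_closedBall _ hr'.le, cube_eq_closedBall _ (by positivity), e] at this
  rw [h.measure_dyadicCell hr, h.measure_dyadicCell hr]
  refine this ?_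
  rw [← e]
  exact closedBall_dyadicCenter_succ_subset hr

/-! ### Stopping-time families of dyadic cells -/

/-- The points of `S`, stopped at generation `N`, select a countable disjoint family of cells as
soon as `N` and membership in `S` are constant on each selected cell. An inequality between two
measures on the selected cells then holds on `S`. -/
theorem measure_le_mul_of_dyadicCell {μ ν : Measure (Fin n → ℝ)} {S : Set (Fin n → ℝ)}
    {N : (Fin n → ℝ) → ℕ} {a b : ℝ≥0∞}
    (hS : ∀ x ∈ S, dyadicCell c r (N x) x ⊆ S)
    (hN : ∀ x ∈ S, ∀ y ∈ dyadicCell c r (N x) x, N y = N x)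
    (h : ∀ x ∈ S, a * μ (dyadicCell c r (N x) x) ≤ b * ν (dyadicCell c r (N x) x)) :
    MeasurableSet S ∧ a * μ S ≤ b * ν S := by
  set F : Set (Set (Fin n → ℝ)) := (fun x => dyadicCell c r (N x) x) '' S
  have hFc : F.Countable := by
    refine (Set.countable_iUnion fun m => countable_range_dyadicCell (c := c) (r := r)
      (m := m)).mono ?_
    rintro _ ⟨x, -, rfl⟩
    exact Set.mem_iUnion.2 ⟨N x, x, rfl⟩
  have hFm : ∀ P ∈ F, MeasurableSet P := by
    rintro _ ⟨x, -, rfl⟩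
    exact measurableSet_dyadicCell
  have hFd : F.PairwiseDisjoint id := by
    rintro _ ⟨x, hx, rfl⟩ _ ⟨y, hy, rfl⟩ hne
    refine Set.disjoint_left.2 fun z hzx hzy => hne ?_
    have h1 := hN x hx z hzx
    have h2 := hN y hy z hzy
    have h3 := dyadicCell_eq_of_mem hzx
    have h4 := dyadicCell_eq_of_mem hzy
    rw [← h1] at h3
    rw [← h2] at h4
    change dyadicCell c r (N x) x = dyadicCell c r (N y) y
    rw [← h1, ← h2]
    exact h3.symm.trans h4
  have hU : S = ⋃ P ∈ F, id P := by
    refine Set.Subset.antisymm (fun x hx => Set.mem_biUnion ⟨x, hx, rfl⟩ mem_dyadicCell_self) ?_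
    refine Set.iUnion₂_subset ?_
    rintro _ ⟨x, hx, rfl⟩
    exact hS x hx
  refine ⟨hU ▸ MeasurableSet.biUnion hFc hFm, ?_⟩
  rw [hU, measure_biUnion hFc hFd hFm, measure_biUnion hFc hFd hFm, ← ENNReal.tsum_mul_left,
    ← ENNReal.tsum_mul_left]
  refine ENNReal.tsum_le_tsum ?_
  rintro ⟨_, x, hx, rfl⟩
  exact h x hx

end Dyadic

/-! ### Calderón–Zygmund decomposition at geometric levels -/

/-- The points of the half-open cube with centre `c` and side length `2 * r` at which the dyadic
maximal function of `ν` relative to `μ` exceeds `lam`. -/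
def dyadicLevelSet {n : ℕ} (μ ν : Measure (Fin n → ℝ)) (c : Fin n → ℝ) (r : ℝ) (lam : ℝ≥0∞) :
    Set (Fin n → ℝ) :=
  {x ∈ dyadicCell c r 0 c | ∃ m, lam * μ (dyadicCell c r m x) < ν (dyadicCell c r m x)}

/-- The first generation at which the dyadic cell containing `x` has `ν`-measure exceeding `lam`
times its `μ`-measure, and `0` if there is none. -/
noncomputable def dyadicStoppingTime {n : ℕ} (μ ν : Measure (Fin n → ℝ)) (c : Fin n → ℝ) (r : ℝ)
    (lam : ℝ≥0∞) (x : Fin n → ℝ) : ℕ :=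
  sInf {m | lam * μ (dyadicCell c r m x) < ν (dyadicCell c r m x)}

section LevelSet

variable {n : ℕ} {μ ν : Measure (Fin n → ℝ)} {c : Fin n → ℝ} {r : ℝ} {lam lam' : ℝ≥0∞}
  {x y : Fin n → ℝ}

theorem dyadicLevelSet_subset : dyadicLevelSet μ ν c r lam ⊆ dyadicCell c r 0 c :=
  fun _ hx => hx.1

theorem dyadicStoppingTime_spec (hx : x ∈ dyadicLevelSet μ ν c r lam) :
    lam * μ (dyadicCell c r (dyadicStoppingTime μ ν c r lam x) x) <
      ν (dyadicCell c r (dyadicStoppingTime μ ν c r lam x) x) :=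
  Nat.sInf_mem (s := {m | lam * μ (dyadicCell c r m x) < ν (dyadicCell c r m x)}) hx.2

theorem dyadicStoppingTime_le {m : ℕ}
    (h : lam * μ (dyadicCell c r m x) < ν (dyadicCell c r m x)) :
    dyadicStoppingTime μ ν c r lam x ≤ m :=
  Nat.sInf_le h

theorem dyadicStoppingTime_mono (h : lam ≤ lam') (hx : x ∈ dyadicLevelSet μ ν c r lam') :
    dyadicStoppingTime μ ν c r lam x ≤ dyadicStoppingTime μ ν c r lam' x :=
  dyadicStoppingTime_le ((mul_le_mul_left h _).trans_lt (dyadicStoppingTime_spec hx))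

theorem dyadicCell_stoppingTime_subset_levelSet (hx : x ∈ dyadicLevelSet μ ν c r lam) :
    dyadicCell c r (dyadicStoppingTime μ ν c r lam x) x ⊆ dyadicLevelSet μ ν c r lam := by
  intro y hy
  have hy0 := dyadicCell_subset_of_le (Nat.zero_le _) hy
  rw [dyadicCell_eq_of_mem hx.1] at hy0
  refine ⟨hy0, dyadicStoppingTime μ ν c r lam x, ?_⟩
  rw [dyadicCell_eq_of_mem hy]
  exact dyadicStoppingTime_spec hx

theorem dyadicStoppingTime_eq_of_mem (hx : x ∈ dyadicLevelSet μ ν c r lam)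
    (hy : y ∈ dyadicCell c r (dyadicStoppingTime μ ν c r lam x) x) :
    dyadicStoppingTime μ ν c r lam y = dyadicStoppingTime μ ν c r lam x := by
  have h1 : dyadicStoppingTime μ ν c r lam y ≤ dyadicStoppingTime μ ν c r lam x := by
    refine dyadicStoppingTime_le ?_
    rw [dyadicCell_eq_of_mem hy]
    exact dyadicStoppingTime_spec hx
  refine le_antisymm h1 (dyadicStoppingTime_le ?_)
  rw [← dyadicCell_eq_of_mem (dyadicCell_subset_of_le h1 hy)]
  exact dyadicStoppingTime_spec (dyadicCell_stoppingTime_subset_levelSet hx hy)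

theorem measurableSet_dyadicLevelSet : MeasurableSet (dyadicLevelSet μ ν c r lam) :=
  (measure_le_mul_of_dyadicCell (μ := μ) (ν := ν) (a := 0) (b := 0)
    (fun _ hx => dyadicCell_stoppingTime_subset_levelSet hx)
    (fun _ hx _ hy => dyadicStoppingTime_eq_of_mem hx hy) (by simp)).1

/-- The weak-type estimate, localized to a stopping cell of a lower level. -/
theorem mul_measure_dyadicLevelSet_inter_le (h : lam ≤ lam')
    (hx : x ∈ dyadicLevelSet μ ν c r lam) :
    lam' * μ (dyadicLevelSet μ ν c r lam' ∩
        dyadicCell c r (dyadicStoppingTime μ ν c r lam x) x) ≤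
      ν (dyadicCell c r (dyadicStoppingTime μ ν c r lam x) x) := by
  have := (measure_le_mul_of_dyadicCell (c := c) (r := r) (μ := μ) (ν := ν) (a := lam') (b := 1)
    (S := dyadicLevelSet μ ν c r lam' ∩ dyadicCell c r (dyadicStoppingTime μ ν c r lam x) x)
    (N := dyadicStoppingTime μ ν c r lam')
    (fun y hy => Set.subset_inter (dyadicCell_stoppingTime_subset_levelSet hy.1) ?_)
    (fun y hy z hz => dyadicStoppingTime_eq_of_mem hy.1 hz)
    (fun y hy => by rw [one_mul]; exact (dyadicStoppingTime_spec hy.1).le)).2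
  · rw [one_mul] at this
    exact this.trans (measure_mono Set.inter_subset_right)
  · rw [← dyadicCell_eq_of_mem hy.2]
    refine dyadicCell_subset_of_le ?_
    rw [← dyadicStoppingTime_eq_of_mem hx hy.2]
    exact dyadicStoppingTime_mono h hy.1

end LevelSet

/-- Subsets of a cube of relative `μ`-measure at most `α` have relative `ν`-measure at most `β`:
the scale-invariant absolute continuity behind the classes `C(δ)`. -/
def IsAbsContOnCubes {n : ℕ} (ν μ : Measure (Fin n → ℝ)) (α β : ℝ≥0∞) : Prop :=
  ∀ (c : Fin n → ℝ) (r : ℝ), 0 < r → ∀ E : Set (Fin n → ℝ), MeasurableSet E →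
    E ⊆ closedBall c r → μ E ≤ α * μ (closedBall c r) → ν E ≤ β * ν (closedBall c r)

/-- Raising the level by the factor `A / α` shrinks the `ν`-measure of the level set by the factor
`β`: on a stopping cell the density is at most `A * lam`, since its parent was not selected, so the
higher level set occupies at most the fraction `α` of it. -/
theorem IsAbsContOnCubes.measure_dyadicLevelSet_le {n : ℕ} {μ ν : Measure (Fin n → ℝ)}
    [IsLocallyFiniteMeasure μ] [IsLocallyFiniteMeasure ν] {α β : ℝ≥0∞}
    (h : IsAbsContOnCubes ν μ α β) (hμ : IsDoubling μ) (hν : IsDoubling ν)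
    {A : ℝ≥0} (hA : IsDoublingConst μ A) {c : Fin n → ℝ} {r : ℝ} (hr : 0 < r)
    {lam lam' : ℝ≥0∞} (h0 : ν (dyadicCell c r 0 c) ≤ lam * μ (dyadicCell c r 0 c))
    (hle : lam ≤ lam') (hlam0 : lam' ≠ 0) (hlamt : lam' ≠ ∞) (hlam : lam * A = lam' * α) :
    ν (dyadicLevelSet μ ν c r lam') ≤ β * ν (dyadicLevelSet μ ν c r lam) := by
  have key : ∀ x ∈ dyadicLevelSet μ ν c r lam,
      ν (dyadicLevelSet μ ν c r lam' ∩ dyadicCell c r (dyadicStoppingTime μ ν c r lam x) x) ≤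
        β * ν (dyadicCell c r (dyadicStoppingTime μ ν c r lam x) x) := by
    intro x hx
    have hweak := mul_measure_dyadicLevelSet_inter_le hle hx
    have hspec := dyadicStoppingTime_spec hx
    have hmin : ∀ m, m < dyadicStoppingTime μ ν c r lam x →
        ν (dyadicCell c r m x) ≤ lam * μ (dyadicCell c r m x) := fun m hm =>
      not_lt.1 fun h' => (dyadicStoppingTime_le h').not_gt hm
    generalize hN : dyadicStoppingTime μ ν c r lam x = N at hweak hspec hmin
    obtain ⟨k, rfl⟩ : ∃ k, N = k + 1 := by
      refine Nat.exists_eq_succ_of_ne_zero fun hN0 => ?_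
      rw [hN0, dyadicCell_eq_of_mem hx.1] at hspec
      exact hspec.not_ge h0
    have hup : ν (dyadicCell c r (k + 1) x) ≤ lam' * (α * μ (dyadicCell c r (k + 1) x)) := by
      calc ν (dyadicCell c r (k + 1) x) ≤ ν (dyadicCell c r k x) :=
            measure_mono dyadicCell_succ_subset
        _ ≤ lam * μ (dyadicCell c r k x) := hmin k (Nat.lt_succ_self k)
        _ ≤ lam * (A * μ (dyadicCell c r (k + 1) x)) := by
            gcongr; exact hA.measure_dyadicCell_le hμ hr
        _ = _ := by rw [← mul_assoc, hlam, mul_assoc]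
    have hμE := (ENNReal.mul_le_mul_iff_right hlam0 hlamt).1 (hweak.trans hup)
    rw [hμ.measure_dyadicCell hr] at hμE
    rw [hν.measure_dyadicCell hr]
    exact h _ _ (by positivity) _
      (measurableSet_dyadicLevelSet.inter measurableSet_dyadicCell)
      (Set.inter_subset_right.trans (dyadicCell_subset_closedBall hr)) hμE
  have := (measure_le_mul_of_dyadicCell (c := c) (r := r) (a := 1) (b := β) (ν := ν)
    (μ := ν.restrict (dyadicLevelSet μ ν c r lam')) (S := dyadicLevelSet μ ν c r lam)
    (fun _ hx => dyadicCell_stoppingTime_subset_levelSet hx)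
    (fun _ hx _ hy => dyadicStoppingTime_eq_of_mem hx hy)
    (fun x hx => by
      rw [one_mul, Measure.restrict_apply measurableSet_dyadicCell, Set.inter_comm]
      exact key x hx)).2
  rw [one_mul, Measure.restrict_apply measurableSet_dyadicLevelSet] at this
  have hsub : dyadicLevelSet μ ν c r lam' ⊆
      dyadicLevelSet μ ν c r lam ∩ dyadicLevelSet μ ν c r lam' := fun x hx =>
    ⟨⟨hx.1, _, (mul_le_mul_left hle _).trans_lt (dyadicStoppingTime_spec hx)⟩, hx⟩
  exact (measure_mono hsub).trans this

/-- Lebesgue's density theorem turns absolute continuity on cubes into absolute continuity. -/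
theorem IsAbsContOnCubes.absolutelyContinuous {n : ℕ} {μ ν : Measure (Fin n → ℝ)}
    [IsLocallyFiniteMeasure ν] {α β : ℝ≥0∞} (h : IsAbsContOnCubes ν μ α β)
    (hβ : β < 1) : ν ≪ μ := by
  refine Measure.AbsolutelyContinuous.mk fun s hs hμs => ?_
  rw [← Measure.restrict_eq_zero, ← ae_eq_bot]
  by_contra hne
  have : NeBot (ae (ν.restrict s)) := ⟨hne⟩
  obtain ⟨x, hx⟩ := (Besicovitch.ae_tendsto_measure_inter_div ν s).exists
  refine hβ.not_ge (le_of_tendsto hx ?_)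
  filter_upwards [self_mem_nhdsWithin] with r hr
  refine ENNReal.div_le_of_le_mul (h x r hr _ (hs.inter measurableSet_closedBall)
    Set.inter_subset_right ?_)
  rw [measure_mono_null Set.inter_subset_left hμs]
  exact zero_le

/-- Outside the level sets the Radon–Nikodym derivative is bounded by the level. -/
theorem IsDoubling.ae_rnDeriv_le {n : ℕ} {μ : Measure (Fin n → ℝ)} (ν : Measure (Fin n → ℝ))
    [IsLocallyFiniteMeasure μ] [IsLocallyFiniteMeasure ν] (hμ : IsDoubling μ)
    (hν : IsDoubling ν) (c : Fin n → ℝ) {r : ℝ} (hr : 0 < r) :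
    ∀ᵐ x ∂μ, ∀ lam : ℝ≥0∞, x ∈ dyadicCell c r 0 c → x ∉ dyadicLevelSet μ ν c r lam →
      ν.rnDeriv μ x ≤ lam := by
  have := hμ.isUnifLocDoublingMeasure
  filter_upwards [(IsUnifLocDoublingMeasure.vitaliFamily μ 1).ae_tendsto_rnDeriv ν] with x hx lam
    hxQ hxL
  have hlim : Tendsto (fun m : ℕ => r / 2 ^ m) atTop (𝓝[>] 0) := by
    refine tendsto_nhdsWithin_iff.2 ⟨?_, Eventually.of_forall fun m => ?_⟩
    · exact tendsto_const_nhds.div_atTop (tendsto_pow_atTop_atTop_of_one_lt one_lt_two)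
    · exact div_pos hr (by positivity)
  have hfil := IsUnifLocDoublingMeasure.tendsto_closedBall_filterAt μ (K := 1) (x := x)
    (fun m => dyadicCenter c r m x) (fun m : ℕ => r / 2 ^ m) hlim
    (Eventually.of_forall fun m => by
      rw [one_mul]; exact dyadicCell_subset_closedBall hr mem_dyadicCell_self)
  refine le_of_tendsto (hx.comp hfil) (Eventually.of_forall fun m => ?_)
  refine ENNReal.div_le_of_le_mul ?_
  rw [← hμ.measure_dyadicCell hr, ← hν.measure_dyadicCell hr]
  exact not_lt.1 fun h' => hxL ⟨hxQ, m, h'⟩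

/-! ### The reverse Hölder inequality -/

/-- Summation over the level sets `Ω k` of the levels `lam * L ^ k`: the density is at most
`lam * L ^ (k + 1)` on `Ω k \ Ω (k + 1)`, while `ν (Ω k) ≤ β ^ k * ν Q`. -/
theorem IsAbsContOnCubes.setLIntegral_rnDeriv_rpow_le {n : ℕ} {μ ν : Measure (Fin n → ℝ)}
    [IsLocallyFiniteMeasure μ] [IsLocallyFiniteMeasure ν] {α β : ℝ≥0∞}
    (h : IsAbsContOnCubes ν μ α β) (hβ : β < 1) (hα0 : α ≠ 0) (hα1 : α ≤ 1)
    (hμ : IsDoubling μ) (hν : IsDoubling ν) (hμ0 : μ ≠ 0) (hν0 : ν ≠ 0)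
    {A : ℝ≥0} (hA : IsDoublingConst μ A) (hA1 : 1 ≤ A) {ε : ℝ} (hε : 0 < ε)
    {c : Fin n → ℝ} {r : ℝ} (hr : 0 < r) :
    ∫⁻ x in dyadicCell c r 0 c, ν.rnDeriv μ x ^ ε ∂ν ≤
      (1 + (A / α) ^ ε * (1 - (A / α) ^ ε * β)⁻¹) *
        (ν (dyadicCell c r 0 c) / μ (dyadicCell c r 0 c)) ^ ε * ν (dyadicCell c r 0 c) := by
  have hμm := hμ.measure_dyadicCell (c := c) (m := 0) (x := c) hr
  have hνm := hν.measure_dyadicCell (c := c) (m := 0) (x := c) hr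
  have hμQ0 : μ (dyadicCell c r 0 c) ≠ 0 := by
    rw [hμm]; exact hμ.measure_closedBall_ne_zero hμ0 _ (by positivity)
  have hνQ0 : ν (dyadicCell c r 0 c) ≠ 0 := by
    rw [hνm]; exact hν.measure_closedBall_ne_zero hν0 _ (by positivity)
  have hμQt : μ (dyadicCell c r 0 c) ≠ ∞ := by rw [hμm]; exact measure_closedBall_lt_top.ne
  have hνQt : ν (dyadicCell c r 0 c) ≠ ∞ := by rw [hνm]; exact measure_closedBall_lt_top.ne
  set Q := dyadicCell c r 0 c
  set lam := ν Q / μ Q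
  have hlam0 : lam ≠ 0 := ENNReal.div_ne_zero.2 ⟨hνQ0, hμQt⟩
  have hlamt : lam ≠ ∞ := ENNReal.div_ne_top hνQt hμQ0
  have hαt : α ≠ ∞ := ne_top_of_le_ne_top ENNReal.one_ne_top hα1
  set L : ℝ≥0∞ := A / α
  have hLt : L ≠ ∞ := ENNReal.div_ne_top ENNReal.coe_ne_top hα0
  have hL1 : 1 ≤ L := by
    rw [ENNReal.le_div_iff_mul_le (Or.inl hα0) (Or.inl hαt), one_mul]
    exact hα1.trans (by exact_mod_cast hA1)
  set ℓ : ℕ → ℝ≥0∞ := fun k => lam * L ^ k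
  set Ω : ℕ → Set (Fin n → ℝ) := fun k => dyadicLevelSet μ ν c r (ℓ k)
  have hℓ0 : ∀ k, ℓ k ≠ 0 := fun k =>
    mul_ne_zero hlam0 (pow_ne_zero _ (zero_lt_one.trans_le hL1).ne')
  have hℓt : ∀ k, ℓ k ≠ ∞ := fun k => ENNReal.mul_ne_top hlamt (ENNReal.pow_ne_top hLt)
  have hℓlam : ∀ k, lam ≤ ℓ k := fun k => le_mul_of_one_le_right' (one_le_pow₀ hL1)
  have hℓsucc : ∀ k, ℓ (k + 1) = ℓ k * L := fun k => by simp only [ℓ, pow_succ, mul_assoc]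
  have hdecay : ∀ k, ν (Ω k) ≤ β ^ k * ν Q := by
    intro k
    induction k with
    | zero => simpa using measure_mono dyadicLevelSet_subset
    | succ k ih =>
      calc ν (Ω (k + 1)) ≤ β * ν (Ω k) := by
            refine h.measure_dyadicLevelSet_le hμ hν hA hr ?_ ?_ (hℓ0 _) (hℓt _) ?_
            · rw [← ENNReal.div_le_iff hμQ0 hμQt]; exact hℓlam k
            · rw [hℓsucc]; exact le_mul_of_one_le_right' hL1
            · rw [hℓsucc, mul_assoc (ℓ k), ENNReal.div_mul_cancel hα0 hαt]
        _ ≤ β * (β ^ k * ν Q) := by gcongr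
        _ = β ^ (k + 1) * ν Q := by ring
  have hnull : ν (⋂ k, Ω k) = 0 := by
    have hlim : Tendsto (fun k : ℕ => β ^ k * ν Q) atTop (𝓝 0) := by
      have := ENNReal.Tendsto.mul_const (ENNReal.tendsto_pow_atTop_nhds_zero_of_lt_one hβ)
        (Or.inr hνQt)
      rwa [zero_mul] at this
    exact nonpos_iff_eq_zero.1 (ge_of_tendsto' hlim fun k =>
      (measure_mono (Set.iInter_subset _ k)).trans (hdecay k))
  have hpt : ∀ᵐ x ∂ν.restrict Q, ν.rnDeriv μ x ^ ε ≤
      lam ^ ε + ∑' k, (Ω k).indicator (fun _ => ℓ (k + 1) ^ ε) x := by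
    have hac := (h.absolutelyContinuous hβ).ae_le (hμ.ae_rnDeriv_le ν hν c hr)
    have hnull' : ∀ᵐ x ∂ν, x ∉ ⋂ k, Ω k := measure_eq_zero_iff_ae_notMem.1 hnull
    filter_upwards [ae_restrict_of_ae hac, ae_restrict_of_ae hnull',
      ae_restrict_mem measurableSet_dyadicCell] with x hx hxn hxQ
    have hex : ∃ k, x ∉ Ω k := by simpa using hxn
    classical
    rcases hk : Nat.find hex with _ | k
    · have h0 := Nat.find_spec hex
      rw [hk] at h0
      have := hx (ℓ 0) hxQ h0
      simp only [ℓ, pow_zero, mul_one] at this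
      exact (ENNReal.rpow_le_rpow this hε.le).trans le_self_add
    · have h1 := Nat.find_spec hex
      rw [hk] at h1
      have h2 : x ∈ Ω k := not_not.1 (Nat.find_min hex (by omega))
      calc ν.rnDeriv μ x ^ ε ≤ ℓ (k + 1) ^ ε := ENNReal.rpow_le_rpow (hx _ hxQ h1) hε.le
        _ = (Ω k).indicator (fun _ => ℓ (k + 1) ^ ε) x := by rw [Set.indicator_of_mem h2]
        _ ≤ ∑' k, (Ω k).indicator (fun _ => ℓ (k + 1) ^ ε) x :=
            ENNReal.le_tsum (f := fun k => (Ω k).indicator (fun _ => ℓ (k + 1) ^ ε) x) k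
        _ ≤ _ := le_add_self
  have hℓpow : ∀ k, ℓ (k + 1) ^ ε = lam ^ ε * L ^ ε * (L ^ ε) ^ k := by
    intro k
    simp only [ℓ]
    rw [ENNReal.mul_rpow_of_nonneg _ _ hε.le, pow_succ', ENNReal.mul_rpow_of_nonneg _ _ hε.le,
      ← mul_assoc]
    congr 1
    rw [← ENNReal.rpow_natCast, ← ENNReal.rpow_natCast, ← ENNReal.rpow_mul, ← ENNReal.rpow_mul,
      mul_comm]
  calc ∫⁻ x in Q, ν.rnDeriv μ x ^ ε ∂ν
      ≤ ∫⁻ x in Q, (lam ^ ε + ∑' k, (Ω k).indicator (fun _ => ℓ (k + 1) ^ ε) x) ∂ν :=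
        lintegral_mono_ae hpt
    _ = lam ^ ε * ν Q + ∑' k, ∫⁻ x in Q, (Ω k).indicator (fun _ => ℓ (k + 1) ^ ε) x ∂ν := by
        rw [lintegral_add_left measurable_const, setLIntegral_const, lintegral_tsum fun k =>
          (measurable_const.indicator measurableSet_dyadicLevelSet).aemeasurable]
    _ ≤ lam ^ ε * ν Q + ∑' k, ℓ (k + 1) ^ ε * (β ^ k * ν Q) := by
        gcongr with k
        refine (lintegral_indicator_const_le _ _).trans ?_
        gcongr
        exact (Measure.restrict_apply_le _ _).trans (hdecay k)
    _ = lam ^ ε * ν Q + ∑' k, lam ^ ε * L ^ ε * ν Q * (L ^ ε * β) ^ k := by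
        congr 2
        funext k
        rw [hℓpow, mul_pow]
        ring
    _ = _ := by
        rw [ENNReal.tsum_mul_left, ENNReal.tsum_geometric]
        ring

theorem Measure.ofReal_toReal_rnDeriv_ae_eq {X : Type*} [MeasurableSpace X] (ν μ : Measure X)
    [SigmaFinite ν] :
    (fun x => ENNReal.ofReal (ν.rnDeriv μ x).toReal) =ᵐ[μ] ν.rnDeriv μ := by
  filter_upwards [Measure.rnDeriv_lt_top ν μ] with x hx using ENNReal.ofReal_toReal hx.ne

/-- The density is the Radon–Nikodym derivative `w`, and `∫ w ^ (1 + ε) ∂μ = ∫ w ^ ε ∂ν`. -/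
theorem IsAbsContOnCubes.hasReverseHolderDensity {n : ℕ} {μ ν : Measure (Fin n → ℝ)}
    [IsLocallyFiniteMeasure μ] [IsLocallyFiniteMeasure ν] {α β : ℝ≥0∞}
    (h : IsAbsContOnCubes ν μ α β) (hβ : β < 1) (hα0 : α ≠ 0) (hα1 : α ≤ 1)
    (hμ : IsDoubling μ) (hν : IsDoubling ν) (hμ0 : μ ≠ 0) (hν0 : ν ≠ 0)
    {A : ℝ≥0} (hA : IsDoublingConst μ A) (hA1 : 1 ≤ A) {ε : ℝ} (hε : 0 < ε)
    (hq : ((A : ℝ≥0∞) / α) ^ ε * β < 1) : HasReverseHolderDensity ν μ ε := by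
  have hac := h.absolutelyContinuous hβ
  have hσ := Measure.ofReal_toReal_rnDeriv_ae_eq ν μ
  have hwd : ν = μ.withDensity (fun x => ENNReal.ofReal (ν.rnDeriv μ x).toReal) := by
    rw [withDensity_congr_ae hσ, Measure.withDensity_rnDeriv_eq ν μ hac]
  refine ⟨fun x => (ν.rnDeriv μ x).toReal, fun x => ENNReal.toReal_nonneg, ?_, hwd, ?_⟩
  · refine locallyIntegrable_iff.2 fun k hk => ?_
    exact integrable_toReal_of_lintegral_ne_top (Measure.measurable_rnDeriv ν μ).aemeasurable
      ((Measure.setLIntegral_rnDeriv_le k).trans_lt hk.measure_lt_top).ne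
  set K : ℝ≥0∞ := 1 + (A / α) ^ ε * (1 - (A / α) ^ ε * β)⁻¹
  have hKt : K ≠ ∞ := by
    refine ENNReal.add_ne_top.2 ⟨ENNReal.one_ne_top, ENNReal.mul_ne_top ?_ ?_⟩
    · exact ENNReal.rpow_ne_top_of_nonneg hε.le (ENNReal.div_ne_top ENNReal.coe_ne_top hα0)
    · exact ENNReal.inv_ne_top.2 (tsub_pos_of_lt hq).ne'
  have hp0 : 0 < 1 + ε := by linarith
  refine ⟨(K ^ (1 / (1 + ε))).toNNReal, fun c r hr => ?_⟩
  rw [ENNReal.coe_toNNReal (ENNReal.rpow_ne_top_of_nonneg (by positivity) hKt),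
    cube_eq_closedBall c hr.le]
  have hball : closedBall (dyadicCenter c r 0 c) (r / 2 ^ 0) = closedBall c r := by
    rw [dyadicCenter_zero hr, pow_zero, div_one]
  have hμm := hμ.measure_dyadicCell (c := c) (m := 0) (x := c) hr
  have hνm := hν.measure_dyadicCell (c := c) (m := 0) (x := c) hr
  have hsub := dyadicCell_subset_closedBall (c := c) (m := 0) (x := c) hr
  rw [hball] at hμm hνm hsub
  have hμQ0 := hμ.measure_closedBall_ne_zero hμ0 c hr
  have hνQ0 := hν.measure_closedBall_ne_zero hν0 c hr
  have hμQt : μ (closedBall c r) ≠ ∞ := measure_closedBall_lt_top.ne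
  have hνQt : ν (closedBall c r) ≠ ∞ := measure_closedBall_lt_top.ne
  have hint1 : ∫⁻ x in closedBall c r, ENNReal.ofReal (ν.rnDeriv μ x).toReal ∂μ =
      ν (closedBall c r) := by
    rw [← withDensity_apply _ measurableSet_closedBall, ← hwd]
  have hint2 : ∫⁻ x in closedBall c r, ENNReal.ofReal (ν.rnDeriv μ x).toReal ^ (1 + ε) ∂μ =
      ∫⁻ x in dyadicCell c r 0 c, ν.rnDeriv μ x ^ ε ∂ν := by
    have hQ : dyadicCell c r 0 c =ᵐ[μ] closedBall c r :=
      ae_eq_of_subset_of_measure_ge hsub hμm.ge measurableSet_dyadicCell.nullMeasurableSet hμQt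
    rw [← setLIntegral_congr hQ, ← setLIntegral_rnDeriv_mul hac
      ((Measure.measurable_rnDeriv ν μ).pow_const ε).aemeasurable measurableSet_dyadicCell]
    refine lintegral_congr_ae (ae_restrict_of_ae ?_)
    filter_upwards [hσ] with x hx
    rw [hx, ENNReal.rpow_add_of_nonneg _ _ zero_le_one hε.le, ENNReal.rpow_one]
  have hmain := h.setLIntegral_rnDeriv_rpow_le hβ hα0 hα1 hμ hν hμ0 hν0 hA hA1 hε (c := c) hr
  rw [← hint2, hμm, hνm] at hmain
  rw [hint1]
  set lam := ν (closedBall c r) / μ (closedBall c r)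
  have hdiv : (∫⁻ x in closedBall c r, ENNReal.ofReal (ν.rnDeriv μ x).toReal ^ (1 + ε) ∂μ) /
      μ (closedBall c r) ≤ K * lam ^ (1 + ε) := by
    refine (ENNReal.div_le_div_right hmain _).trans (le_of_eq ?_)
    rw [mul_div_assoc, ENNReal.rpow_add_of_nonneg _ _ zero_le_one hε.le, ENNReal.rpow_one]
    ring
  refine (ENNReal.rpow_le_rpow hdiv (by positivity)).trans (le_of_eq ?_)
  rw [ENNReal.mul_rpow_of_nonneg _ _ (by positivity), ← ENNReal.rpow_mul, mul_one_div,
    div_self hp0.ne', ENNReal.rpow_one]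

/-! ### Comparability and absolute continuity on cubes -/

theorem IsDoublingConst.one_le {n : ℕ} {μ : Measure (Fin n → ℝ)} [IsLocallyFiniteMeasure μ]
    (hμ : IsDoubling μ) (hμ0 : μ ≠ 0) {A : ℝ≥0} (hA : IsDoublingConst μ A) : 1 ≤ A := by
  have hsub : cube (0 : Fin n → ℝ) 1 ⊆ cube 0 (2 * 1) := fun x hx i => (hx i).trans (by norm_num)
  have h := (hA 0 0 1 one_pos hsub).trans (mul_le_mul_right (measure_mono hsub) _)
  have h0 := hμ.measure_cube_ne_zero hμ0 0 (r := 2 * 1) (by norm_num)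
  have ht := measure_cube_ne_top μ 0 (r := 2 * 1) (by norm_num)
  rw [← ENNReal.div_le_iff h0 ht, ENNReal.div_self h0 ht] at h
  exact_mod_cast h

theorem ComparableWith.one_le {n : ℕ} {μ₁ μ₂ : Measure (Fin n → ℝ)}
    [IsLocallyFiniteMeasure μ₁] [IsLocallyFiniteMeasure μ₂] (h₁ : IsDoubling μ₁)
    (h₂ : IsDoubling μ₂) (hμ₁ : μ₁ ≠ 0) (hμ₂ : μ₂ ≠ 0) {C : ℝ≥0} {δ : ℝ}
    (h : ComparableWith μ₁ μ₂ C δ) : 1 ≤ C := by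
  have := h.div_closedBall_le (c := 0) one_pos measurableSet_closedBall subset_rfl
  rw [ENNReal.div_self (h₁.measure_closedBall_ne_zero hμ₁ _ one_pos) measure_closedBall_lt_top.ne,
    ENNReal.div_self (h₂.measure_closedBall_ne_zero hμ₂ _ one_pos) measure_closedBall_lt_top.ne,
    ENNReal.one_rpow, mul_one] at this
  exact_mod_cast this

theorem ComparableWith.isAbsContOnCubes {n : ℕ} {μ₁ μ₂ : Measure (Fin n → ℝ)}
    [IsLocallyFiniteMeasure μ₁] (h₁ : IsDoubling μ₁) (hμ₁ : μ₁ ≠ 0) {C : ℝ≥0} (hC : C ≠ 0)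
    {δ : ℝ} (hδ : 0 < δ) (h : ComparableWith μ₁ μ₂ C δ) :
    IsAbsContOnCubes μ₁ μ₂ ((2 * C) ^ (-(1 / δ)) : ℝ≥0) (1 / 2 : ℝ≥0) := by
  intro c r hr E hE hEQ hμE
  rw [← ENNReal.div_le_iff (h₁.measure_closedBall_ne_zero hμ₁ c hr) measure_closedBall_lt_top.ne]
  have hα : C * ((2 * C) ^ (-(1 / δ)) : ℝ≥0) ^ δ = 1 / 2 := by
    rw [← NNReal.rpow_mul, neg_mul, one_div_mul_cancel hδ.ne', NNReal.rpow_neg_one]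
    field_simp
  rw [← hα, ENNReal.coe_mul, ENNReal.coe_rpow_of_nonneg _ hδ.le]
  refine (h.div_closedBall_le hr hE hEQ).trans ?_
  gcongr
  exact ENNReal.div_le_of_le_mul hμE

theorem NNReal.two_mul_rpow_neg_one_div_lt_one {C : ℝ≥0} (hC : 1 ≤ C) {δ : ℝ} (hδ : 0 < δ) :
    (2 * C) ^ (-(1 / δ)) < 1 := by
  refine NNReal.rpow_lt_one_of_one_lt_of_neg (lt_of_lt_of_le one_lt_two ?_) (by simpa using hδ)
  exact le_mul_of_one_le_right' hC

/-- If `E` is at most half of a cube for `μ₁`, its complement in the cube is at least half of it,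
hence has relative `μ₂`-measure at least `(2 * C) ^ (-(1 / δ))`. -/
theorem ComparableWith.isAbsContOnCubes_swap {n : ℕ} {μ₁ μ₂ : Measure (Fin n → ℝ)}
    [IsLocallyFiniteMeasure μ₁] [IsLocallyFiniteMeasure μ₂] (h₁ : IsDoubling μ₁)
    (h₂ : IsDoubling μ₂) (hμ₁ : μ₁ ≠ 0) (hμ₂ : μ₂ ≠ 0) {C : ℝ≥0} (hC : 1 ≤ C)
    {δ : ℝ} (hδ : 0 < δ) (h : ComparableWith μ₁ μ₂ C δ) :
    IsAbsContOnCubes μ₂ μ₁ (1 / 2 : ℝ≥0) (1 - (2 * C) ^ (-(1 / δ)) : ℝ≥0) := by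
  intro c r hr E hE hEQ hμE
  set α : ℝ≥0 := (2 * C) ^ (-(1 / δ)) with hα
  have hα1 : α < 1 := NNReal.two_mul_rpow_neg_one_div_lt_one hC hδ
  set Q := closedBall c r
  have h10 : μ₁ Q ≠ 0 := h₁.measure_closedBall_ne_zero hμ₁ c hr
  have h1t : μ₁ Q ≠ ∞ := measure_closedBall_lt_top.ne
  have h20 : μ₂ Q ≠ 0 := h₂.measure_closedBall_ne_zero hμ₂ c hr
  have h2t : μ₂ Q ≠ ∞ := measure_closedBall_lt_top.ne
  have hhalf : μ₁ Q ≤ 2 * μ₁ (Q \ E) := by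
    have hsplit := measure_inter_add_sdiff (μ := μ₁) Q hE
    rw [Set.inter_eq_right.2 hEQ] at hsplit
    have hEt : μ₁ E ≠ ∞ := ne_top_of_le_ne_top h1t (measure_mono hEQ)
    have hEle : 2 * μ₁ E ≤ μ₁ Q := by
      calc 2 * μ₁ E ≤ 2 * (((1 / 2 : ℝ≥0) : ℝ≥0∞) * μ₁ Q) := by gcongr
        _ = ((2 * (1 / 2) : ℝ≥0) : ℝ≥0∞) * μ₁ Q := by rw [← mul_assoc]; norm_cast
        _ = μ₁ Q := by norm_num
    have h2 : μ₁ E ≤ μ₁ (Q \ E) := by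
      rw [← hsplit, two_mul] at hEle
      exact (ENNReal.add_le_add_iff_left hEt).1 hEle
    calc μ₁ Q = μ₁ E + μ₁ (Q \ E) := hsplit.symm
      _ ≤ μ₁ (Q \ E) + μ₁ (Q \ E) := by gcongr
      _ = _ := (two_mul _).symm
  have hcomp := h.div_closedBall_le hr (measurableSet_closedBall.diff hE)
    (Set.sdiff_subset (s := Q) (t := E))
  have hone : 1 ≤ ((2 * C : ℝ≥0) : ℝ≥0∞) * (μ₂ (Q \ E) / μ₂ Q) ^ δ := by
    calc (1 : ℝ≥0∞) = μ₁ Q / μ₁ Q := (ENNReal.div_self h10 h1t).symm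
      _ ≤ 2 * μ₁ (Q \ E) / μ₁ Q := by gcongr
      _ = 2 * (μ₁ (Q \ E) / μ₁ Q) := mul_div_assoc _ _ _
      _ ≤ 2 * (C * (μ₂ (Q \ E) / μ₂ Q) ^ δ) := by gcongr
      _ = _ := by push_cast; ring
  have hx := ENNReal.one_le_rpow_inv_mul_of_one_le hδ hone
  have hcompl : α * μ₂ Q ≤ μ₂ (Q \ E) := by
    rw [← ENNReal.le_div_iff_mul_le (Or.inl h20) (Or.inl h2t)]
    have hαinv : (α : ℝ≥0∞) * ((2 * C : ℝ≥0) : ℝ≥0∞) ^ δ⁻¹ = 1 := by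
      rw [← ENNReal.coe_rpow_of_nonneg _ (inv_nonneg.2 hδ.le), ← ENNReal.coe_mul, hα,
        ← NNReal.rpow_add (by positivity), one_div, neg_add_cancel, NNReal.rpow_zero,
        ENNReal.coe_one]
    calc (α : ℝ≥0∞) = α * 1 := (mul_one _).symm
      _ ≤ α * (((2 * C : ℝ≥0) : ℝ≥0∞) ^ δ⁻¹ * (μ₂ (Q \ E) / μ₂ Q)) := by gcongr
      _ = _ := by rw [← mul_assoc, hαinv, one_mul]
  have hfin : (α : ℝ≥0∞) * μ₂ Q ≠ ∞ := ENNReal.mul_ne_top ENNReal.coe_ne_top h2t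
  refine (ENNReal.add_le_add_iff_left hfin).1 ?_
  calc α * μ₂ Q + μ₂ E ≤ μ₂ (Q \ E) + μ₂ E := by gcongr
    _ = μ₂ Q := by
      have hsplit := measure_inter_add_sdiff (μ := μ₂) Q hE
      rw [Set.inter_eq_right.2 hEQ] at hsplit
      rw [add_comm, hsplit]
    _ = α * μ₂ Q + ((1 - α : ℝ≥0) : ℝ≥0∞) * μ₂ Q := by
      rw [← add_mul, ← ENNReal.coe_add, add_tsub_cancel_of_le hα1.le, ENNReal.coe_one, one_mul]

/-- The factor `1 / 2` in the exponent leaves room for strict inequality: the left-hand side is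
`β ^ (1 / 2)`. -/
theorem div_rpow_mul_lt_one {A α β : ℝ≥0} (hA : 1 ≤ A) (hα0 : 0 < α) (hα1 : α < 1)
    (hβ0 : 0 < β) (hβ1 : β < 1) {ε : ℝ}
    (hε : ε = -(1 / 2) * Real.log β / (Real.log A - Real.log α)) (hε0 : 0 < ε) :
    ((A : ℝ≥0∞) / (α : ℝ≥0∞)) ^ ε * β < 1 := by
  rw [← ENNReal.coe_div hα0.ne', ← ENNReal.coe_rpow_of_nonneg _ hε0.le, ← ENNReal.coe_mul,
    ENNReal.coe_lt_one_iff, ← NNReal.coe_lt_coe]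
  push_cast
  have hA' : (1 : ℝ) ≤ A := by exact_mod_cast hA
  have hα0' : (0 : ℝ) < α := by exact_mod_cast hα0
  have hα1' : (α : ℝ) < 1 := by exact_mod_cast hα1
  have hβ0' : (0 : ℝ) < β := by exact_mod_cast hβ0
  have hβ1' : (β : ℝ) < 1 := by exact_mod_cast hβ1
  have hd : 0 < Real.log A - Real.log α := by
    linarith [Real.log_nonneg hA', Real.log_neg hα0' hα1']
  have hlog : Real.log (((A : ℝ) / α) ^ ε * β) = 1 / 2 * Real.log β := by
    rw [Real.log_mul (by positivity) hβ0'.ne', Real.log_rpow (by positivity),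
      Real.log_div (by positivity) hα0'.ne', hε, div_mul_cancel₀ _ hd.ne']
    ring
  rw [← Real.log_neg_iff (by positivity), hlog]
  linarith [Real.log_neg hβ0' hβ1']

theorem ComparableWith.hasReverseHolderDensity {n : ℕ} {μ₁ μ₂ : Measure (Fin n → ℝ)}
    [IsLocallyFiniteMeasure μ₁] [IsLocallyFiniteMeasure μ₂] (h₁ : IsDoubling μ₁)
    (h₂ : IsDoubling μ₂) (hμ₁ : μ₁ ≠ 0) (hμ₂ : μ₂ ≠ 0) {C : ℝ≥0} {δ : ℝ} (hδ : 0 < δ)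
    (h : ComparableWith μ₁ μ₂ C δ) {A : ℝ≥0} (hA : IsDoublingConst μ₂ A) :
    HasReverseHolderDensity μ₁ μ₂ (epsFun A C δ) := by
  have hC := h.one_le h₁ h₂ hμ₁ hμ₂
  have hA1 := hA.one_le h₂ hμ₂
  have hε : 0 < epsFun A C δ :=
    (epsFun_properties (by exact_mod_cast hA1) (by exact_mod_cast hC)).1 δ hδ
  have hα0 : 0 < (2 * C) ^ (-(1 / δ)) := NNReal.rpow_pos (by positivity)
  have hα1 := NNReal.two_mul_rpow_neg_one_div_lt_one hC hδ
  have hhalf : (1 / 2 : ℝ≥0) < 1 := NNReal.coe_lt_coe.1 (by norm_num)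
  refine (h.isAbsContOnCubes h₁ hμ₁ (by positivity) hδ).hasReverseHolderDensity
    (by exact_mod_cast hhalf) (by exact_mod_cast hα0.ne') (by exact_mod_cast hα1.le)
    h₂ h₁ hμ₂ hμ₁ hA hA1 hε (div_rpow_mul_lt_one hA1 hα0 hα1 (by norm_num) hhalf ?_ hε)
  rw [epsFun]
  push_cast
  rw [Real.log_rpow (by positivity)]
  congr 1
  ring

theorem ComparableWith.hasReverseHolderDensity_swap {n : ℕ} {μ₁ μ₂ : Measure (Fin n → ℝ)}
    [IsLocallyFiniteMeasure μ₁] [IsLocallyFiniteMeasure μ₂] (h₁ : IsDoubling μ₁)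
    (h₂ : IsDoubling μ₂) (hμ₁ : μ₁ ≠ 0) (hμ₂ : μ₂ ≠ 0) {C : ℝ≥0} {δ : ℝ} (hδ : 0 < δ)
    (h : ComparableWith μ₁ μ₂ C δ) {A : ℝ≥0} (hA : IsDoublingConst μ₁ A) :
    HasReverseHolderDensity μ₂ μ₁ (epsFunSwap A C δ) := by
  have hC := h.one_le h₁ h₂ hμ₁ hμ₂
  have hA1 := hA.one_le h₁ hμ₁
  have hε : 0 < epsFunSwap A C δ :=
    (epsFunSwap_properties (by exact_mod_cast hA1) (by exact_mod_cast hC)).1 δ hδ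
  have hα0 : 0 < (2 * C) ^ (-(1 / δ)) := NNReal.rpow_pos (by positivity)
  have hα1 := NNReal.two_mul_rpow_neg_one_div_lt_one hC hδ
  have hhalf : (1 / 2 : ℝ≥0) < 1 := NNReal.coe_lt_coe.1 (by norm_num)
  have hβ0 : 0 < 1 - (2 * C) ^ (-(1 / δ)) := tsub_pos_of_lt hα1
  have hβ1 : 1 - (2 * C) ^ (-(1 / δ)) < 1 := tsub_lt_self one_pos hα0
  refine (h.isAbsContOnCubes_swap h₁ h₂ hμ₁ hμ₂ hC hδ).hasReverseHolderDensity
    (by exact_mod_cast hβ1) (by norm_num) (by exact_mod_cast hhalf.le)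
    h₁ h₂ hμ₁ hμ₂ hA hA1 hε (div_rpow_mul_lt_one hA1 (by norm_num) hhalf hβ0 hβ1 ?_ hε)
  rw [epsFunSwap, NNReal.coe_sub hα1.le]
  push_cast
  rw [one_div (2 : ℝ), Real.log_inv, sub_neg_eq_add]

theorem theorem3 {n : ℕ} (μ₁ μ₂ : Measure (Fin n → ℝ))
    [IsLocallyFiniteMeasure μ₁] [IsLocallyFiniteMeasure μ₂] (hμ₁ : μ₁ ≠ 0) (hμ₂ : μ₂ ≠ 0) :
    -- comparability transfers the doubling property, in both directions
    (∀ δ : ℝ, (IsDoubling μ₁ ∨ IsDoubling μ₂) → MemC μ₁ μ₂ δ → IsDoubling μ₁ ∧ IsDoubling μ₂) ∧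
    -- the exponent functions are positive, continuous and increasing on `(0, ∞)`
    (∀ A C : ℝ, 1 ≤ A → 1 ≤ C →
      ((∀ δ : ℝ, 0 < δ → 0 < epsFun A C δ) ∧
        ContinuousOn (epsFun A C) (Set.Ioi 0) ∧ StrictMonoOn (epsFun A C) (Set.Ioi 0)) ∧
      ((∀ δ : ℝ, 0 < δ → 0 < epsFunSwap A C δ) ∧
        ContinuousOn (epsFunSwap A C) (Set.Ioi 0) ∧ StrictMonoOn (epsFunSwap A C) (Set.Ioi 0))) ∧
    (IsDoubling μ₁ → IsDoubling μ₂ →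
      -- (i) implies (ii): each measure has a reverse Hölder density with respect to the other
      (∀ (C : ℝ≥0) (δ : ℝ), 0 < δ → ComparableWith μ₁ μ₂ C δ →
        1 ≤ C ∧
        (∃ A : ℝ≥0, IsDoublingConst μ₁ A) ∧ (∃ A : ℝ≥0, IsDoublingConst μ₂ A) ∧
        (∀ A : ℝ≥0, IsDoublingConst μ₂ A →
          1 ≤ A ∧ HasReverseHolderDensity μ₁ μ₂ (epsFun A C δ)) ∧
        (∀ A : ℝ≥0, IsDoublingConst μ₁ A →
          1 ≤ A ∧ HasReverseHolderDensity μ₂ μ₁ (epsFunSwap A C δ))) ∧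
      -- (ii) implies (iii)
      (∀ ε : ℝ, 0 < ε → HasReverseHolderDensity μ₁ μ₂ ε → MemC μ₁ μ₂ (ε / (1 + ε))) ∧
      (∀ ε : ℝ, 0 < ε → HasReverseHolderDensity μ₂ μ₁ ε → MemC μ₂ μ₁ (ε / (1 + ε)))) := by
  refine ⟨?_, fun A C hA hC => ⟨epsFun_properties hA hC, epsFunSwap_properties hA hC⟩, ?_⟩
  · rintro δ (h₁ | h₂) ⟨hδ, C, h⟩
    · exact ⟨h₁, h.isDoubling_right hμ₁ hδ h₁⟩
    · exact ⟨h.isDoubling_left hδ h₂, h₂⟩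
  · intro h₁ h₂
    refine ⟨fun C δ hδ h => ⟨h.one_le h₁ h₂ hμ₁ hμ₂,
      (isDoubling_iff_exists_isDoublingConst μ₁).1 h₁,
      (isDoubling_iff_exists_isDoublingConst μ₂).1 h₂, fun A hA => ⟨hA.one_le h₂ hμ₂, ?_⟩,
      fun A hA => ⟨hA.one_le h₁ hμ₁, ?_⟩⟩, fun ε hε h => ?_, fun ε hε h => ?_⟩
    · exact h.hasReverseHolderDensity h₁ h₂ hμ₁ hμ₂ hδ hA
    · exact h.hasReverseHolderDensity_swap h₁ h₂ hμ₁ hμ₂ hδ hA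
    · exact h.memC (fun c r hr => h₂.measure_cube_ne_zero hμ₂ c hr) hε
    · exact h.memC (fun c r hr => h₁.measure_cube_ne_zero hμ₁ c hr) hε
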